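/- There are universal constants $C_1, C_2, C_3, C_4 > 0$ such that the following holds. Let $K, N \ge 2$ and $L$ be natural numbers with $$C_1 K \le L \le \frac{KN}{36}.$$ Let $F \in \mathbb{C}^{L\times L}$ be the normalized (unitary) discrete Fourier matrix. For $B \in \mathbb{C}^{L \times K}$ let $b_\ell \in \mathbb{C}^K$ be the $\ell$-th row of $\overline{FB}$ (as a column vector). Let $C \in \mathbb{C}^{L \times N}$ be a random matrix whose entries are independent circularly symmetric complex normal variables with mean $0$ and $\mathbb{E}|C_{ij}|^2 = 1/L$, and let $c_\ell \in \mathbb{C}^N$ be the $\ell$-th row of $\sqrt{L}\,FC$. Define the measurement operator $\mathcal{A}:\mathbb{C}^{K\times N}\to\mathbb{C}^L$ by $(\mathcal{A}(X))(\ell) = \langle b_\ell c_\ell^*, X\rangle_F = \operatorname{Tr}\big((b_\ell c_\ell^*)^* X\big)$. Write $\|\cdot\|$ for the Euclidean norm, $\|\cdot\|_F$ for the Frobenius norm and $\|\cdot\|_*$ for the nuclear norm (the sum of the singular values). Then there is a matrix $B\in\mathbb{C}^{L\times K}$ with $B^*B = \mathrm{Id}_K$ and such that all rows of $FB$ have equal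 norm, i.e. $\mu_{\max}^2 := \frac{L}{K}\max_\ell \|b_\ell\|^2 = 1$, such that for all $h_0 \in \mathbb{C}^K\setminus\{0\}$ and $m_0\in\mathbb{C}^N\setminus\{0\}$ the following holds. With probability at least $$1 - C_4\exp\Big(-\frac{K}{C_2\,\mu_{h_0}^2}\Big),\qquad \mu_{h_0}^2 := \frac{L}{\|h_0\|^2}\max_{\ell}|\langle b_\ell,h_0\rangle|^2,$$ there is $\tau_0>0$ such that for every $0\le\tau\le\tau_0$ there exist a noise vector $e\in\mathbb{C}^L$ with $\|e\|\le\tau$ and a matrix $\tilde X\in\mathbb{C}^{K\times N}$ such that, with $X_0 = h_0m_0^*$ and $y = \mathcal{A}(X_0)+e$, * $\|\mathcal{A}(\tilde X)-y\| = \tau$, * $\|\tilde X\|_* \le \|X_0\|_*$, * $\|\tilde X - X_0\|_F \ge \dfrac{\tau}{C_3}\sqrt{\dfrac{KN}{L}}$. -/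

import Mathlib

open MeasureTheory ProbabilityTheory
open scoped Matrix NNReal

/-- The circularly symmetric complex normal distribution on `ℂ` with mean `0` and `E|z|² = v`:
the real and imaginary parts are independent real Gaussians with mean `0` and variance `v / 2`. -/
noncomputable def complexGaussian (v : ℝ≥0) : Measure ℂ :=
  ((gaussianReal 0 (v / 2)).prod (gaussianReal 0 (v / 2))).map
    (fun p : ℝ × ℝ => (p.1 : ℂ) + (p.2 : ℂ) * Complex.I)

/-- The law of an `L × N` random matrix (given by its entries) whose entries are independent and
circularly symmetric complex normal with mean `0` and variance `1 / L`. -/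
noncomputable def codingLaw (L N : ℕ) : Measure (Fin L → Fin N → ℂ) :=
  Measure.pi fun _ : Fin L => Measure.pi fun _ : Fin N => complexGaussian (1 / (L : ℝ≥0))

/-- The normalized (unitary) discrete Fourier matrix, with entries
`exp (-2 π i j k / L) / √L`. -/
noncomputable def dftMatrix (L : ℕ) : Matrix (Fin L) (Fin L) ℂ :=
  Matrix.of fun j k =>
    Complex.exp (-2 * Real.pi * Complex.I * ((j : ℕ) : ℂ) * ((k : ℕ) : ℂ) / (L : ℂ)) /
      (Real.sqrt L : ℂ)

/-- `b_ℓ`: the `ℓ`-th row of the entrywise complex conjugate of `F B`, as a column vector. -/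
noncomputable def bVec {L K : ℕ} (B : Matrix (Fin L) (Fin K) ℂ) (l : Fin L) :
    EuclideanSpace ℂ (Fin K) :=
  WithLp.toLp 2 fun k => star ((dftMatrix L * B) l k)

/-- `c_ℓ`: the `ℓ`-th row of `√L F C`, as a column vector. -/
noncomputable def cVec {L N : ℕ} (C : Matrix (Fin L) (Fin N) ℂ) (l : Fin L) :
    EuclideanSpace ℂ (Fin N) :=
  WithLp.toLp 2 fun n => (Real.sqrt L : ℂ) * (dftMatrix L * C) l n

/-- The rank-one matrix `u v*`. -/
def outer {K N : ℕ} (u : EuclideanSpace ℂ (Fin K)) (v : EuclideanSpace ℂ (Fin N)) :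
    Matrix (Fin K) (Fin N) ℂ :=
  Matrix.of fun k n => u k * star (v n)

/-- The Frobenius inner product `⟨Z, W⟩_F = Tr (Z* W)`. -/
def frobInner {K N : ℕ} (Z W : Matrix (Fin K) (Fin N) ℂ) : ℂ := (Zᴴ * W).trace

/-- The Frobenius norm. -/
noncomputable def frobNorm {K N : ℕ} (Z : Matrix (Fin K) (Fin N) ℂ) : ℝ :=
  Real.sqrt (∑ k, ∑ n, ‖Z k n‖ ^ 2)

/-- The nuclear norm: the sum of the singular values. The matrix has `N` columns, so the singular
values with index at least `N` vanish. -/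
noncomputable def nuclearNorm {K N : ℕ} (Z : Matrix (Fin K) (Fin N) ℂ) : ℝ :=
  ∑ i ∈ Finset.range N, (Matrix.toEuclideanLin Z).singularValues i

/-- The blind deconvolution measurement operator, `(𝒜 X)(ℓ) = ⟨b_ℓ c_ℓ*, X⟩_F`. -/
noncomputable def measOp {L K N : ℕ} (B : Matrix (Fin L) (Fin K) ℂ)
    (C : Matrix (Fin L) (Fin N) ℂ) (X : Matrix (Fin K) (Fin N) ℂ) :
    EuclideanSpace ℂ (Fin L) :=
  WithLp.toLp 2 fun l => frobInner (outer (bVec B l) (cVec C l)) X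

/-- The coherence parameter `μ_max² = (L / K) max_ℓ ‖b_ℓ‖²`. -/
noncomputable def muMaxSq {L K : ℕ} (B : Matrix (Fin L) (Fin K) ℂ) : ℝ :=
  (L : ℝ) / K * ⨆ l : Fin L, ‖bVec B l‖ ^ 2

/-- The coherence parameter `μ_{h₀}² = (L / ‖h₀‖²) max_ℓ |⟨b_ℓ, h₀⟩|²`. -/
noncomputable def muSq {L K : ℕ} (B : Matrix (Fin L) (Fin K) ℂ)
    (h₀ : EuclideanSpace ℂ (Fin K)) : ℝ :=
  (L : ℝ) / ‖h₀‖ ^ 2 * ⨆ l : Fin L, ‖inner ℂ (bVec B l) h₀‖ ^ 2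

/-- Instability of the recovery of `X₀ = h₀ m₀*` at small noise levels, with error at least
`κ` times the noise level: for all sufficiently small `τ` there are noise `e` with `‖e‖ ≤ τ` and a
feasible alternative `X'` for the measurements `y = 𝒜 X₀ + e` whose nuclear norm is at most that of
`X₀`, but whose Frobenius distance from `X₀` is at least `κ τ`. -/
def UnstableAt {L K N : ℕ} (B : Matrix (Fin L) (Fin K) ℂ) (C : Matrix (Fin L) (Fin N) ℂ)
    (h₀ : EuclideanSpace ℂ (Fin K)) (m₀ : EuclideanSpace ℂ (Fin N)) (κ : ℝ) : Prop :=
  ∃ τ₀ : ℝ, 0 < τ₀ ∧ ∀ τ : ℝ, 0 ≤ τ → τ ≤ τ₀ →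
    ∃ e : EuclideanSpace ℂ (Fin L), ‖e‖ ≤ τ ∧
      ∃ X' : Matrix (Fin K) (Fin N) ℂ,
        ‖measOp B C X' - (measOp B C (outer h₀ m₀) + e)‖ = τ ∧
        nuclearNorm X' ≤ nuclearNorm (outer h₀ m₀) ∧
        κ * τ ≤ frobNorm (X' - outer h₀ m₀)

/-!
Since `K N ≥ 36 L`, the measurement operator is far from injective, but an arbitrary element of its
kernel is useless: the perturbed matrix must not have larger nuclear norm than `X₀ = σ u v*`
(`u`, `v` unit vectors, `σ = ‖h₀‖ ‖m₀‖`). Put `ε = √(L / (K N)) ≤ 1/6`. The descent direction is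
`Z = -3 ε u v* ± x (v - w)*`, where `x` is a standard basis vector of `ℂ^K` and `w` is the
orthogonal projection of `v` onto the span of those `c_ℓ` for which `⟨b_ℓ, x⟩ ≠ 0`.

* Every measurement of `x (v - w)*` vanishes, so `‖𝒜 Z‖ = 3 ε ‖𝒜 (u v*)‖ ≤ 6 ε`, while `‖Z‖_F` is
  bounded below by a constant as long as `w` is short.
* `X₀ + t Z = ((σ - 3 ε t) u ± t x) v* ∓ t x w*`. With the sign for which `± Re ⟨u, x⟩ ≤ 0`, the
  first summand has nuclear norm at most `σ - 3 ε t + O(t²)`, and the second has nuclear norm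
  `t ‖w‖`. Hence `‖w‖ < 3 ε` suffices for small `t` (`unstableAt_of_descent`); this only needs the
  triangle inequality for the nuclear norm of two rank-one matrices
  (`nuclearNorm_outer_add_outer_le`).

It remains to choose `B` so that `w` is short for at least one choice of `x`. Take `F B` to be a
sparse tight frame with rows of equal norm ("spectral tetris", `exists_sparse_tight_frame`): each
column is supported on about `L / K` consecutive rows, and the supports of the columns with even
index are disjoint. Then `w` is the projection of `v` onto the span of at most `2 L / K` Gaussian
vectors of `ℂ^N`. The law of `F C` is that of `C` (`map_mul_mul_codingLaw`), and rotating `v` onto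
each standard basis vector in turn shows `E ‖w‖² ≤ (2 L / K) / N = 2 ε²`
(`integral_norm_spanProj_sq_le`). By Markov's inequality `‖w‖² > 6 ε²` has probability at most
`1/3`, and the `K / 2` events for the even columns are independent, so all of them occur with
probability at most `3 ^ (-⌊K / 2⌋)` (`measure_forall_lt_norm_spanProj_le`). Finally
`‖𝒜 (u v*)‖²` is a sum of independent exponential variables with weights at most
`μ_{h₀}² / L` that sum to `1`, and Chernoff's bound gives `‖𝒜 (u v*)‖ < 2` outside an event of
probability `exp (-L / μ_{h₀}²)` (`measure_four_le_sum_inner_le`).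
-/

/-! ### Nuclear norm of sums of rank-one matrices -/

/-- The right singular vectors: an orthonormal basis whose images under `Z` are pairwise orthogonal,
the lengths of these images being the singular values. -/
theorem exists_orthonormalBasis_nuclearNorm_eq_sum {K N : ℕ} (Z : Matrix (Fin K) (Fin N) ℂ) :
    ∃ b : OrthonormalBasis (Fin N) ℂ (EuclideanSpace ℂ (Fin N)),
      (∀ i j, i ≠ j → inner ℂ (Matrix.toEuclideanLin Z (b i)) (Matrix.toEuclideanLin Z (b j)) = 0) ∧
      nuclearNorm Z = ∑ i, ‖Matrix.toEuclideanLin Z (b i)‖ := by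
  set T := Matrix.toEuclideanLin Z with hT
  have hn : Module.finrank ℂ (EuclideanSpace ℂ (Fin N)) = N := finrank_euclideanSpace_fin
  have hS := T.isSymmetric_adjoint_comp_self
  have key : ∀ i j, inner ℂ (T (hS.eigenvectorBasis hn i)) (T (hS.eigenvectorBasis hn j)) =
      (hS.eigenvalues hn j : ℂ) *
        inner ℂ (hS.eigenvectorBasis hn i) (hS.eigenvectorBasis hn j) := by
    intro i j
    rw [← LinearMap.adjoint_inner_right, ← LinearMap.comp_apply, hS.apply_eigenvectorBasis,
      inner_smul_right]
    rfl
  refine ⟨hS.eigenvectorBasis hn, ?_, ?_⟩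
  · intro i j hij
    rw [key, (hS.eigenvectorBasis hn).orthonormal.2 hij, mul_zero]
  · rw [nuclearNorm, Finset.sum_range]
    refine Finset.sum_congr rfl fun i _ => ?_
    rw [T.singularValues_fin hn i]
    have h := key i i
    rw [inner_self_eq_norm_sq_to_K, inner_self_eq_norm_sq_to_K,
      (hS.eigenvectorBasis hn).orthonormal.1 i] at h
    have h' : ‖T (hS.eigenvectorBasis hn i)‖ ^ 2 = hS.eigenvalues hn i := by
      simp only [Complex.coe_algebraMap, Complex.ofReal_one, one_pow, mul_one] at h
      exact_mod_cast h
    rw [← h', Real.sqrt_sq (norm_nonneg _)]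

theorem toEuclideanLin_outer {K N : ℕ} (u : EuclideanSpace ℂ (Fin K))
    (v x : EuclideanSpace ℂ (Fin N)) :
    Matrix.toEuclideanLin (outer u v) x = inner ℂ v x • u := by
  ext k
  simp [Matrix.toEuclideanLin, outer, Matrix.mulVec, dotProduct, PiLp.inner_apply, Finset.sum_mul]
  refine Finset.sum_congr rfl fun i _ => ?_
  ring

theorem sqrt_sum_sq_le_sum_norm {ι E : Type*} [Fintype ι] [NormedAddCommGroup E] (f : ι → E) :
    √(∑ i, ‖f i‖ ^ 2) ≤ ∑ i, ‖f i‖ := by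
  rw [Real.sqrt_le_left (by positivity)]
  exact Finset.sum_sq_le_sq_sum_of_nonneg fun i _ => norm_nonneg _

/-- In the basis of right singular vectors the nuclear norm of `u v*` is the `ℓ¹`-norm of the
coordinates of `v` times `‖u‖`, which dominates the `ℓ²`-norm. -/
theorem norm_mul_norm_le_nuclearNorm_outer {K N : ℕ} (u : EuclideanSpace ℂ (Fin K))
    (v : EuclideanSpace ℂ (Fin N)) : ‖u‖ * ‖v‖ ≤ nuclearNorm (outer u v) := by
  obtain ⟨b, -, hb⟩ := exists_orthonormalBasis_nuclearNorm_eq_sum (outer u v)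
  rw [hb]
  simp only [toEuclideanLin_outer, norm_smul]
  rw [← Finset.sum_mul, mul_comm]
  refine mul_le_mul_of_nonneg_right ?_ (norm_nonneg _)
  refine le_trans (le_of_eq ?_) (sqrt_sum_sq_le_sum_norm _)
  rw [b.sum_sq_norm_inner_left, Real.sqrt_sq (norm_nonneg _)]

/-- Cauchy–Schwarz and Bessel's inequality for two orthonormal families, the first one being
orthonormal only over the index set `s`. -/
theorem sum_norm_inner_mul_norm_inner_le {ι E F : Type*} [Fintype ι]
    [NormedAddCommGroup E] [InnerProductSpace ℂ E] [NormedAddCommGroup F] [InnerProductSpace ℂ F]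
    {f : ι → E} {g : ι → F} (s : Finset ι) (hf : Orthonormal ℂ (fun i : s => f i))
    (hg : Orthonormal ℂ g) (a : E) (b : F) :
    ∑ i ∈ s, ‖inner ℂ (f i) a‖ * ‖inner ℂ (g i) b‖ ≤ ‖a‖ * ‖b‖ := by
  refine (Real.sum_mul_le_sqrt_mul_sqrt _ _ _).trans ?_
  gcongr
  · rw [Real.sqrt_le_left (norm_nonneg _), ← Finset.sum_coe_sort s (fun i => ‖inner ℂ (f i) a‖ ^ 2)]
    exact hf.sum_inner_products_le a
  · rw [Real.sqrt_le_left (norm_nonneg _)]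
    exact hg.sum_inner_products_le b

/-- The triangle inequality for the nuclear norm of a sum of two rank-one matrices. With right and
left singular vectors `b i` and `f i`, the nuclear norm is `∑ i, ⟨f i, Z (b i)⟩` over the indices of
the nonzero singular values; each rank-one summand is then estimated by Bessel's inequality. -/
theorem nuclearNorm_outer_add_outer_le {K N : ℕ} (u u' : EuclideanSpace ℂ (Fin K))
    (v v' : EuclideanSpace ℂ (Fin N)) :
    nuclearNorm (outer u v + outer u' v') ≤ ‖u‖ * ‖v‖ + ‖u'‖ * ‖v'‖ := by
  classical
  obtain ⟨b, hb, hsum⟩ := exists_orthonormalBasis_nuclearNorm_eq_sum (outer u v + outer u' v')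
  set T := Matrix.toEuclideanLin (outer u v + outer u' v') with hT
  -- For a zero singular value `f i` is the junk value `0`, so these indices are left out.
  let s : Finset (Fin N) := Finset.univ.filter fun i => T (b i) ≠ 0
  let f : Fin N → EuclideanSpace ℂ (Fin K) := fun i => ((‖T (b i)‖ : ℂ)⁻¹) • T (b i)
  have hf : Orthonormal ℂ (fun i : s => f i) := by
    constructor
    · rintro ⟨i, hi⟩
      have hi' : T (b i) ≠ 0 := by simpa [s] using hi
      simp [f, norm_smul, hi']
    · rintro ⟨i, hi⟩ ⟨j, hj⟩ hij
      have hij' : i ≠ j := fun h => hij (Subtype.ext h)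
      simp [f, inner_smul_left, inner_smul_right, hb i j hij']
  have hTb : ∀ i, T (b i) = inner ℂ v (b i) • u + inner ℂ v' (b i) • u' := by
    intro i
    rw [hT, map_add, LinearMap.add_apply, toEuclideanLin_outer, toEuclideanLin_outer]
  have hterm : ∀ i ∈ s, ‖T (b i)‖ ≤ ‖inner ℂ (f i) u‖ * ‖inner ℂ (b i) v‖ +
      ‖inner ℂ (f i) u'‖ * ‖inner ℂ (b i) v'‖ := by
    intro i hi
    have hi' : T (b i) ≠ 0 := by simpa [s] using hi
    have h1 : ‖T (b i)‖ = ‖inner ℂ (f i) (T (b i))‖ := by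
      have : ‖T (b i)‖ ≠ 0 := by simpa using hi'
      rw [show f i = ((‖T (b i)‖ : ℂ)⁻¹) • T (b i) from rfl, inner_smul_left,
        inner_self_eq_norm_sq_to_K]
      simp
      field_simp
    rw [h1]
    nth_rewrite 1 [hTb]
    rw [inner_add_right, inner_smul_right, inner_smul_right]
    refine (norm_add_le _ _).trans (le_of_eq ?_)
    rw [norm_mul, norm_mul, norm_inner_symm v, norm_inner_symm v', mul_comm,
      mul_comm ‖inner ℂ (b i) v'‖]
  calc nuclearNorm (outer u v + outer u' v') = ∑ i ∈ s, ‖T (b i)‖ := by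
        rw [hsum]
        symm
        apply Finset.sum_subset (Finset.subset_univ _)
        intro i _ hi
        simpa [s] using hi
    _ ≤ ∑ i ∈ s, (‖inner ℂ (f i) u‖ * ‖inner ℂ (b i) v‖ +
      ‖inner ℂ (f i) u'‖ * ‖inner ℂ (b i) v'‖) := Finset.sum_le_sum hterm
    _ ≤ _ := by
      rw [Finset.sum_add_distrib]
      exact add_le_add (sum_norm_inner_mul_norm_inner_le s hf b.orthonormal u v)
        (sum_norm_inner_mul_norm_inner_le s hf b.orthonormal u' v')

/-! ### The descent direction -/

theorem frobNorm_eq_norm_toLp {K N : ℕ} (Z : Matrix (Fin K) (Fin N) ℂ) :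
    frobNorm Z = ‖WithLp.toLp 2 fun p : Fin K × Fin N => Z p.1 p.2‖ := by
  rw [frobNorm, EuclideanSpace.norm_eq, Fintype.sum_prod_type]

theorem frobNorm_outer {K N : ℕ} (u : EuclideanSpace ℂ (Fin K)) (v : EuclideanSpace ℂ (Fin N)) :
    frobNorm (outer u v) = ‖u‖ * ‖v‖ := by
  rw [frobNorm, EuclideanSpace.norm_eq, EuclideanSpace.norm_eq, ← Real.sqrt_mul (by positivity),
    Finset.sum_mul_sum]
  simp [outer, mul_pow]

theorem frobNorm_smul {K N : ℕ} (a : ℂ) (Z : Matrix (Fin K) (Fin N) ℂ) :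
    frobNorm (a • Z) = ‖a‖ * frobNorm Z := by
  rw [frobNorm_eq_norm_toLp, frobNorm_eq_norm_toLp, ← norm_smul]
  rfl

theorem frobNorm_add_le {K N : ℕ} (Z W : Matrix (Fin K) (Fin N) ℂ) :
    frobNorm (Z + W) ≤ frobNorm Z + frobNorm W := by
  simp only [frobNorm_eq_norm_toLp]
  exact norm_add_le (WithLp.toLp 2 fun p : Fin K × Fin N => Z p.1 p.2)
    (WithLp.toLp 2 fun p : Fin K × Fin N => W p.1 p.2)

theorem measOp_add {L K N : ℕ} (B : Matrix (Fin L) (Fin K) ℂ) (C : Matrix (Fin L) (Fin N) ℂ)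
    (X Y : Matrix (Fin K) (Fin N) ℂ) :
    measOp B C (X + Y) = measOp B C X + measOp B C Y := by
  ext l
  simp [measOp, frobInner, Matrix.mul_add, Matrix.trace_add]

theorem measOp_smul {L K N : ℕ} (B : Matrix (Fin L) (Fin K) ℂ) (C : Matrix (Fin L) (Fin N) ℂ)
    (a : ℂ) (X : Matrix (Fin K) (Fin N) ℂ) :
    measOp B C (a • X) = a • measOp B C X := by
  ext l
  simp [measOp, frobInner]

theorem measOp_outer_apply {L K N : ℕ} (B : Matrix (Fin L) (Fin K) ℂ)
    (C : Matrix (Fin L) (Fin N) ℂ) (u : EuclideanSpace ℂ (Fin K)) (v : EuclideanSpace ℂ (Fin N))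
    (l : Fin L) :
    measOp B C (outer u v) l = inner ℂ (bVec B l) u * inner ℂ v (cVec C l) := by
  simp only [measOp, frobInner, Matrix.trace, Matrix.diag, Matrix.mul_apply, outer,
    PiLp.inner_apply, Finset.sum_mul_sum, Matrix.conjTranspose_apply, Matrix.of_apply]
  rw [Finset.sum_comm]
  refine Finset.sum_congr rfl fun k _ => Finset.sum_congr rfl fun n _ => ?_
  simp
  ring

/-- The noise vector: any `a` of norm at most `τ` has a point `e` of the `τ`-ball at distance
exactly `τ`. -/
theorem exists_norm_le_norm_sub_eq {E : Type*} [NormedAddCommGroup E] [NormedSpace ℝ E]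
    [Nontrivial E] {τ : ℝ} {a : E} (ha : ‖a‖ ≤ τ) : ∃ e : E, ‖e‖ ≤ τ ∧ ‖a - e‖ = τ := by
  have hτ : 0 ≤ τ := (norm_nonneg _).trans ha
  by_cases h0 : a = 0
  · obtain ⟨e, he⟩ := exists_norm_eq E hτ
    exact ⟨e, he.le, by simpa [h0] using he⟩
  · have hpos : 0 < ‖a‖ := norm_pos_iff.2 h0
    refine ⟨(1 - τ / ‖a‖) • a, ?_, ?_⟩
    · have h1 : 1 ≤ τ / ‖a‖ := (one_le_div hpos).2 ha
      rw [norm_smul, Real.norm_eq_abs, abs_of_nonpos (by linarith)]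
      field_simp
      linarith
    · rw [show a - (1 - τ / ‖a‖) • a = (τ / ‖a‖) • a by module, norm_smul, Real.norm_eq_abs,
        abs_of_nonneg (by positivity)]
      field_simp

theorem norm_sq_smul_add_smul_le {E : Type*} [NormedAddCommGroup E] [InnerProductSpace ℂ E]
    {u x : E} (hu : ‖u‖ = 1) (hx : ‖x‖ = 1) {a b : ℝ} (ha : 0 ≤ a)
    (h : b * (inner ℂ u x).re ≤ 0) : ‖(a : ℂ) • u + (b : ℂ) • x‖ ^ 2 ≤ a ^ 2 + b ^ 2 := by
  rw [@norm_add_sq ℂ, norm_smul, norm_smul, inner_smul_left, inner_smul_right, hu, hx]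
  simp
  nlinarith

/-- The second-order term `t ^ 2` is absorbed by the gap between the slopes `3 ε` and
`5 / 2 * ε`. -/
theorem sq_sub_add_sq_le {ε σ t : ℝ} (hε : 0 < ε) (hε6 : ε ≤ 1 / 6) (ht0 : 0 ≤ t)
    (htσ : t ≤ ε * σ / 2) : (σ - 3 * ε * t) ^ 2 + t ^ 2 ≤ (σ - 5 / 2 * ε * t) ^ 2 := by
  have h1 : ε ^ 2 ≤ 1 / 36 := by nlinarith
  have h2 : 11 / 4 * ε ^ 2 * t ≤ 1 * t := mul_le_mul_of_nonneg_right (by linarith) ht0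
  have h3 : t * (t + 11 / 4 * ε ^ 2 * t) ≤ t * (ε * σ) :=
    mul_le_mul_of_nonneg_left (by linarith) ht0
  linarith

/-- The deterministic part of the argument, with the perturbation
`t (-3 ε u v* ± x (v - w)*)`, `t = τ / (6 ε)`. -/
theorem unstableAt_of_descent {L K N : ℕ} [NeZero L] {B : Matrix (Fin L) (Fin K) ℂ}
    {C : Matrix (Fin L) (Fin N) ℂ} {h₀ : EuclideanSpace ℂ (Fin K)} {m₀ : EuclideanSpace ℂ (Fin N)}
    (hh : h₀ ≠ 0) (hm : m₀ ≠ 0) {ε : ℝ} (hε : 0 < ε) (hε6 : ε ≤ 1 / 6)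
    {x : EuclideanSpace ℂ (Fin K)} {w v : EuclideanSpace ℂ (Fin N)} {u : EuclideanSpace ℂ (Fin K)}
    (hu : h₀ = (‖h₀‖ : ℂ) • u) (hv : m₀ = (‖m₀‖ : ℂ) • v)
    (hx : ‖x‖ = 1) (hw : ‖w‖ ≤ 5 / 2 * ε) (hvw : 9 / 10 ≤ ‖v - w‖)
    (hker : ∀ l, inner ℂ (bVec B l) x = 0 ∨ inner ℂ (v - w) (cVec C l) = 0)
    (hA : ‖measOp B C (outer u v)‖ ≤ 2) :
    UnstableAt B C h₀ m₀ (1 / 15 * (1 / ε)) := by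
  have hhn : 0 < ‖h₀‖ := norm_pos_iff.2 hh
  have hmn : 0 < ‖m₀‖ := norm_pos_iff.2 hm
  have hu1 : ‖u‖ = 1 := by
    have := congrArg norm hu
    rw [norm_smul, Complex.norm_real, norm_norm] at this
    field_simp at this
    exact this.symm
  have hv1 : ‖v‖ = 1 := by
    have := congrArg norm hv
    rw [norm_smul, Complex.norm_real, norm_norm] at this
    field_simp at this
    exact this.symm
  set σ : ℝ := ‖h₀‖ * ‖m₀‖ with hσ
  have hσ0 : 0 < σ := by positivity
  have hX0 : outer h₀ m₀ = (σ : ℂ) • outer u v := by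
    ext k n
    have h1 : h₀ k = (‖h₀‖ : ℂ) * u k := congrArg (fun z => z k) hu
    have h2 : m₀ n = (‖m₀‖ : ℂ) * v n := congrArg (fun z => z n) hv
    simp only [outer, Matrix.of_apply, Matrix.smul_apply, smul_eq_mul, hσ]
    rw [h1, h2]
    simp
    ring
  obtain ⟨s, hs1, hs⟩ : ∃ s : ℝ, |s| = 1 ∧ s * (inner ℂ u x).re ≤ 0 := by
    rcases le_total (inner ℂ u x).re 0 with h | h
    · exact ⟨1, by simp, by simpa using h⟩
    · exact ⟨-1, by simp, by simpa using h⟩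
  have hss : s ^ 2 = 1 := by rw [← sq_abs, hs1]; norm_num
  have hAx : measOp B C (outer x (v - w)) = 0 := by
    ext l
    rw [measOp_outer_apply]
    rcases hker l with h | h <;> simp [h]
  set Z : Matrix (Fin K) (Fin N) ℂ := ((-(3 * ε) : ℝ) : ℂ) • outer u v + (s : ℂ) • outer x (v - w)
    with hZ
  have hAZ : ‖measOp B C Z‖ ≤ 6 * ε := by
    rw [hZ, measOp_add, measOp_smul, measOp_smul, hAx, smul_zero, add_zero, norm_smul,
      Complex.norm_real, Real.norm_eq_abs, abs_neg, abs_of_pos (by positivity)]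
    nlinarith
  have hFZ : 2 / 5 ≤ frobNorm Z := by
    have h1 : (s : ℂ) • outer x (v - w) = Z + ((3 * ε : ℝ) : ℂ) • outer u v := by
      rw [hZ]; push_cast; module
    have h2 := frobNorm_add_le Z (((3 * ε : ℝ) : ℂ) • outer u v)
    rw [← h1, frobNorm_smul, frobNorm_smul, frobNorm_outer, frobNorm_outer, hx, hu1, hv1,
      Complex.norm_real, Complex.norm_real, Real.norm_eq_abs, Real.norm_eq_abs, hs1,
      abs_of_pos (by positivity)] at h2
    linarith
  refine ⟨3 * ε ^ 2 * σ, by positivity, fun τ hτ hτ0 => ?_⟩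
  set t : ℝ := τ / (6 * ε) with ht
  have ht0 : 0 ≤ t := by positivity
  have htτ : t * (6 * ε) = τ := by rw [ht]; field_simp
  have htσ : t ≤ ε * σ / 2 := by
    rw [ht, div_le_iff₀ (by positivity)]
    linarith
  have hsub : outer h₀ m₀ + (t : ℂ) • Z - outer h₀ m₀ = (t : ℂ) • Z := by abel
  obtain ⟨e, he, he'⟩ : ∃ e : EuclideanSpace ℂ (Fin L), ‖e‖ ≤ τ ∧
      ‖measOp B C ((t : ℂ) • Z) - e‖ = τ := by
    apply exists_norm_le_norm_sub_eq
    rw [measOp_smul, norm_smul, Complex.norm_real, Real.norm_eq_abs, abs_of_nonneg ht0, ← htτ]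
    gcongr
  refine ⟨e, he, outer h₀ m₀ + (t : ℂ) • Z, ?_, ?_, ?_⟩
  · rw [measOp_add, add_sub_add_left_eq_sub]
    exact he'
  · have hdec : outer h₀ m₀ + (t : ℂ) • Z =
        outer (((σ - 3 * ε * t : ℝ) : ℂ) • u + ((t * s : ℝ) : ℂ) • x) v +
        outer (((-(t * s) : ℝ) : ℂ) • x) w := by
      rw [hX0, hZ]
      ext k n
      simp [outer]
      ring
    -- A sum of two rank-one matrices; the tangent space at `X₀` plays no role.
    rw [hdec]
    refine (nuclearNorm_outer_add_outer_le _ _ _ _).trans ?_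
    refine le_trans ?_ (norm_mul_norm_le_nuclearNorm_outer h₀ m₀)
    rw [hv1, norm_smul, hx, Complex.norm_real, Real.norm_eq_abs, abs_neg, abs_mul, hs1,
      abs_of_nonneg ht0, ← hσ, mul_one, mul_one, mul_one]
    have h0 : ε * t ≤ 1 / 6 * (1 / 6 * σ / 2) := by
      have h3 : ε * σ ≤ 1 / 6 * σ := by gcongr
      gcongr
      linarith
    have h2 : ‖((σ - 3 * ε * t : ℝ) : ℂ) • u + ((t * s : ℝ) : ℂ) • x‖ ≤ σ - 5 / 2 * ε * t := by
      refine abs_le_of_sq_le_sq' ?_ (by linarith) |>.2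
      have h4 : t * s * (inner ℂ u x).re ≤ 0 := by
        rw [mul_assoc]; exact mul_nonpos_of_nonneg_of_nonpos ht0 hs
      refine (norm_sq_smul_add_smul_le hu1 hx (by linarith) h4).trans ?_
      rw [mul_pow t s 2, hss, mul_one]
      exact sq_sub_add_sq_le hε hε6 ht0 htσ
    have h5 : t * ‖w‖ ≤ t * (5 / 2 * ε) := by gcongr
    linarith
  · rw [hsub, frobNorm_smul, Complex.norm_real, Real.norm_eq_abs, abs_of_nonneg ht0]
    calc 1 / 15 * (1 / ε) * τ = t * (2 / 5) := by rw [ht]; field_simp; ring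
      _ ≤ _ := by gcongr

/-! ### The discrete Fourier matrix is unitary -/

theorem exp_two_pi_sub_div_ne_one {L : ℕ} {j k : Fin L} (h : j ≠ k) :
    Complex.exp (-2 * Real.pi * Complex.I * (((j : ℕ) : ℂ) - ((k : ℕ) : ℂ)) / (L : ℂ)) ≠ 1 := by
  have hL : (L : ℂ) ≠ 0 := by
    have := j.pos
    exact_mod_cast this.ne'
  rw [Ne, Complex.exp_eq_one_iff]
  rintro ⟨n, hn⟩
  have hpi : (2 * Real.pi * Complex.I : ℂ) ≠ 0 := Complex.two_pi_I_ne_zero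
  have h1 : (2 * Real.pi * Complex.I : ℂ) * (((k : ℕ) : ℂ) - ((j : ℕ) : ℂ)) =
      (2 * Real.pi * Complex.I) * (n * L) := by
    field_simp at hn
    linear_combination (2 * Real.pi * Complex.I) * hn
  have h2 : (((k : ℕ) : ℂ) - ((j : ℕ) : ℂ)) = n * L := mul_left_cancel₀ hpi h1
  have h3 : ((k : ℕ) : ℤ) - ((j : ℕ) : ℤ) = n * L := by exact_mod_cast h2
  have hj := j.isLt
  have hk := k.isLt
  have hn0 : n = 0 := by
    by_contra hne
    rcases lt_or_gt_of_ne hne with hlt | hgt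
    · have : n * (L : ℤ) ≤ -1 * L := by gcongr; omega
      omega
    · have : 1 * (L : ℤ) ≤ n * L := by gcongr; omega
      omega
  rw [hn0] at h3
  exact h (Fin.ext (by omega))

theorem dftMatrix_mul_conjTranspose (L : ℕ) : dftMatrix L * (dftMatrix L)ᴴ = 1 := by
  ext j k
  have hL : (L : ℂ) ≠ 0 := by
    have := j.pos
    exact_mod_cast this.ne'
  have hsq : (Real.sqrt L : ℂ) * (Real.sqrt L : ℂ) = L := by
    rw [← Complex.ofReal_mul, Real.mul_self_sqrt (Nat.cast_nonneg L)]; simp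
  set q := Complex.exp (-2 * Real.pi * Complex.I * (((j : ℕ) : ℂ) - ((k : ℕ) : ℂ)) / (L : ℂ))
    with hq
  have hterm : ∀ l : Fin L, dftMatrix L j l * (dftMatrix L)ᴴ l k = q ^ (l : ℕ) / L := by
    intro l
    rw [Matrix.conjTranspose_apply, dftMatrix, Matrix.of_apply, Matrix.of_apply,
      ← starRingEnd_apply, map_div₀, Complex.conj_ofReal, ← Complex.exp_conj, div_mul_div_comm, hsq,
      ← Complex.exp_add, hq, ← Complex.exp_nat_mul]
    congr 2
    simp [Complex.conj_ofNat]
    ring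
  rw [Matrix.mul_apply, Finset.sum_congr rfl fun l _ => hterm l, ← Finset.sum_div,
    Fin.sum_univ_eq_sum_range (fun l => q ^ l)]
  by_cases h : j = k
  · subst h
    simp [hq, hL]
  · rw [Matrix.one_apply_ne h, geom_sum_eq (hq ▸ exp_two_pi_sub_div_ne_one h), hq,
      ← Complex.exp_nat_mul, mul_div_cancel₀ _ hL,
      Complex.exp_eq_one_iff.2 ⟨((k : ℕ) : ℤ) - ((j : ℕ) : ℤ), by push_cast; ring⟩]
    simp

theorem dftMatrix_mem_unitaryGroup (L : ℕ) : dftMatrix L ∈ Matrix.unitaryGroup (Fin L) ℂ := by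
  rw [Matrix.mem_unitaryGroup_iff]
  exact dftMatrix_mul_conjTranspose L

/-! ### Sparse tight frames with rows of equal norm -/

/-- The first row of the `k`-th block of rows, `⌊k L / K⌋`. Block `k` consists of the rows from
`tetrisStart L K k` up to, but not including, `tetrisStart L K (k + 1)`. -/
def tetrisStart (L K k : ℕ) : ℕ := k * L / K

/-- The fractional part of `k L / K`. -/
noncomputable def tetrisFrac (L K k : ℕ) : ℝ := ((k * L % K : ℕ) : ℝ) / K

/-- The block that contains row `l`, that is, the largest `k` with `⌊k L / K⌋ ≤ l`. -/
def tetrisBlock (L K l : ℕ) : ℕ := ((l + 1) * K - 1) / L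

/-- The entry of row `l` in the column with the index `k` of the block of `l`: `±√(1 - r / 2)` in
the first two rows of the block, where `r` is the fractional part of `k L / K`, and `1` in the
others. -/
noncomputable def tetrisDiag (L K l : ℕ) : ℝ :=
  if l = tetrisStart L K (tetrisBlock L K l) then
    √(1 - tetrisFrac L K (tetrisBlock L K l) / 2)
  else if l = tetrisStart L K (tetrisBlock L K l) + 1 then
    -√(1 - tetrisFrac L K (tetrisBlock L K l) / 2)
  else 1

/-- The entry of row `l` in the column preceding that of its block: `√(r / 2)` in the first two rows
of the block, where `r` is the fractional part of `k L / K`, and `0` in the others. The signs in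
`tetrisDiag` make neighbouring columns orthogonal. -/
noncomputable def tetrisOff (L K l : ℕ) : ℝ :=
  if l = tetrisStart L K (tetrisBlock L K l) ∨ l = tetrisStart L K (tetrisBlock L K l) + 1 then
    √(tetrisFrac L K (tetrisBlock L K l) / 2)
  else 0

/-- The spectral tetris frame, scaled such that its rows have norm `1`. Column `k` has squared norm
`L / K`: it collects the weight `r` of the boundary at `k + 1` and all of block `k` but the weight
of the boundary at `k`. -/
noncomputable def tetrisEntry (L K l k : ℕ) : ℝ :=
  if k = tetrisBlock L K l then tetrisDiag L K l
  else if k + 1 = tetrisBlock L K l then tetrisOff L K l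
  else 0

section Tetris

variable {L K : ℕ}

theorem tetrisStart_add_tetrisFrac (hK : 0 < K) (k : ℕ) :
    (tetrisStart L K k : ℝ) + tetrisFrac L K k = k * L / K := by
  have h : ((K * (k * L / K) + k * L % K : ℕ) : ℝ) = ((k * L : ℕ) : ℝ) := by
    rw [Nat.div_add_mod]
  have hK' : (K : ℝ) ≠ 0 := by exact_mod_cast hK.ne'
  rw [tetrisStart, tetrisFrac]
  push_cast at h ⊢
  field_simp
  linarith

theorem tetrisFrac_nonneg (k : ℕ) : 0 ≤ tetrisFrac L K k := by
  rw [tetrisFrac]; positivity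

theorem tetrisFrac_le_one (k : ℕ) : tetrisFrac L K k ≤ 1 := by
  rw [tetrisFrac]
  rcases K.eq_zero_or_pos with rfl | hK
  · simp
  · refine div_le_one_of_le₀ ?_ (Nat.cast_nonneg K)
    exact_mod_cast (Nat.mod_lt _ hK).le

theorem tetrisStart_add_three_le (hK : 0 < K) (hKL : 3 * K ≤ L) (k : ℕ) :
    tetrisStart L K k + 3 ≤ tetrisStart L K (k + 1) := by
  rw [tetrisStart, tetrisStart, ← Nat.add_mul_div_right _ _ hK]
  exact Nat.div_le_div_right (by rw [add_mul]; omega)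

theorem monotone_tetrisStart : Monotone (tetrisStart L K) := fun _ _ h =>
  Nat.div_le_div_right (Nat.mul_le_mul_right L h)

theorem tetrisStart_le_iff (hK : 0 < K) (hL : 0 < L) {k l : ℕ} :
    tetrisStart L K k ≤ l ↔ k ≤ tetrisBlock L K l := by
  rw [tetrisStart, tetrisBlock, Nat.le_div_iff_mul_le hL, ← Nat.lt_add_one_iff,
    Nat.div_lt_iff_lt_mul hK]
  have : 0 < (l + 1) * K := by positivity
  omega

theorem tetrisBlock_eq (hK : 0 < K) (hL : 0 < L) {k l : ℕ}
    (h : l ∈ Finset.Ico (tetrisStart L K k) (tetrisStart L K (k + 1))) :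
    tetrisBlock L K l = k := by
  rw [Finset.mem_Ico, tetrisStart_le_iff hK hL, ← not_le, tetrisStart_le_iff hK hL] at h
  omega

theorem tetrisBlock_lt (hK : 0 < K) (hL : 0 < L) {l : ℕ} (hl : l < L) : tetrisBlock L K l < K := by
  rw [← not_le, ← tetrisStart_le_iff hK hL, tetrisStart, Nat.mul_div_cancel_left _ hK]
  omega

theorem tetrisDiag_sq_add_tetrisOff_sq (l : ℕ) :
    tetrisDiag L K l ^ 2 + tetrisOff L K l ^ 2 = 1 := by
  have h0 := tetrisFrac_nonneg (L := L) (K := K) (tetrisBlock L K l)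
  have h1 := tetrisFrac_le_one (L := L) (K := K) (tetrisBlock L K l)
  rw [tetrisDiag, tetrisOff]
  split_ifs <;> first | omega | skip
  · rw [Real.sq_sqrt (by linarith), Real.sq_sqrt (by linarith)]; ring
  · rw [neg_sq, Real.sq_sqrt (by linarith), Real.sq_sqrt (by linarith)]; ring
  · norm_num

theorem sum_tetrisEntry_sq (hK : 0 < K) (hL : 0 < L) {l : ℕ} (hl : l < L) :
    ∑ k ∈ Finset.range K, tetrisEntry L K l k ^ 2 = 1 := by
  have hlt := tetrisBlock_lt hK hL hl
  have h : ∀ k, tetrisEntry L K l k ^ 2 =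
      (if k = tetrisBlock L K l then tetrisDiag L K l ^ 2 else 0) +
        if k + 1 = tetrisBlock L K l then tetrisOff L K l ^ 2 else 0 := by
    intro k
    rw [tetrisEntry]
    split_ifs <;> first | omega | simp
  rw [Finset.sum_congr rfl fun k _ => h k, Finset.sum_add_distrib,
    ← tetrisDiag_sq_add_tetrisOff_sq (L := L) (K := K) l]
  congr 1
  · rw [Finset.sum_ite_eq', if_pos (Finset.mem_range.2 hlt)]
  · rcases hc : tetrisBlock L K l with _ | c
    · simp [tetrisOff, hc, tetrisFrac]
    · simp only [Nat.add_right_cancel_iff]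
      rw [Finset.sum_ite_eq', if_pos (Finset.mem_range.2 (by omega))]

theorem sum_range_eq_sum_tetrisBlock (hK : 0 < K) (f : ℕ → ℝ) :
    ∑ l ∈ Finset.range L, f l =
      ∑ c ∈ Finset.range K,
        ∑ l ∈ Finset.Ico (tetrisStart L K c) (tetrisStart L K (c + 1)), f l := by
  have h : ∀ n, ∑ l ∈ Finset.range (tetrisStart L K n), f l =
      ∑ c ∈ Finset.range n,
        ∑ l ∈ Finset.Ico (tetrisStart L K c) (tetrisStart L K (c + 1)), f l := by
    intro n
    induction n with
    | zero => simp [tetrisStart]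
    | succ n ih =>
      rw [Finset.sum_range_succ, ← ih, Finset.sum_range_add_sum_Ico _
        (monotone_tetrisStart n.le_succ)]
  rw [← h, tetrisStart, Nat.mul_div_cancel_left _ hK]

theorem sum_Ico_eq_add_add {m n : ℕ} (h : m + 3 ≤ n) (f : ℕ → ℝ) :
    ∑ l ∈ Finset.Ico m n, f l = f m + f (m + 1) + ∑ l ∈ Finset.Ico (m + 2) n, f l := by
  rw [Finset.sum_eq_sum_Ico_succ_bot (by omega), Finset.sum_eq_sum_Ico_succ_bot (by omega),
    ← add_assoc]

/-- The contribution of the rows of one block to the inner product of two columns. -/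
theorem sum_block_tetrisEntry_mul (hK : 0 < K) (hKL : 3 * K ≤ L) (c k k' : ℕ) :
    ∑ l ∈ Finset.Ico (tetrisStart L K c) (tetrisStart L K (c + 1)),
      tetrisEntry L K l k * tetrisEntry L K l k' =
    (if k = c ∧ k' = c then
      (tetrisStart L K (c + 1) : ℝ) - tetrisStart L K c - tetrisFrac L K c else 0) +
      if k + 1 = c ∧ k' + 1 = c then tetrisFrac L K c else 0 := by
  have hL : 0 < L := by omega
  have h3 := tetrisStart_add_three_le hK hKL c
  have h0 := tetrisFrac_nonneg (L := L) (K := K) c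
  have h1 := tetrisFrac_le_one (L := L) (K := K) c
  set m := tetrisStart L K c with hm
  set n := tetrisStart L K (c + 1) with hn
  set r := tetrisFrac L K c with hr
  have hb : ∀ l, m ≤ l → l < n → tetrisBlock L K l = c := fun l h h' =>
    tetrisBlock_eq hK hL (Finset.mem_Ico.2 ⟨h, h'⟩)
  have hsq1 : √(1 - r / 2) * √(1 - r / 2) = 1 - r / 2 := Real.mul_self_sqrt (by linarith)
  have hsq2 : √(r / 2) * √(r / 2) = r / 2 := Real.mul_self_sqrt (by linarith)
  have e0 : ∀ k, tetrisEntry L K m k =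
      if k = c then √(1 - r / 2) else if k + 1 = c then √(r / 2) else 0 := by
    intro k
    have hbm := hb m le_rfl (by omega)
    simp [tetrisEntry, tetrisDiag, tetrisOff, hbm, ← hm, ← hr]
  have e1 : ∀ k, tetrisEntry L K (m + 1) k =
      if k = c then -√(1 - r / 2) else if k + 1 = c then √(r / 2) else 0 := by
    intro k
    have hbm := hb (m + 1) (by omega) (by omega)
    simp [tetrisEntry, tetrisDiag, tetrisOff, hbm, ← hm, ← hr]
  have e2 : ∀ l ∈ Finset.Ico (m + 2) n, tetrisEntry L K l k * tetrisEntry L K l k' =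
      if k = c ∧ k' = c then 1 else 0 := by
    intro l hl
    rw [Finset.mem_Ico] at hl
    have hbm := hb l (by omega) (by omega)
    have h1 : l ≠ m := by omega
    have h2 : l ≠ m + 1 := by omega
    simp only [tetrisEntry, tetrisDiag, tetrisOff, hbm, ← hm, h1, h2, if_false, or_self]
    split_ifs <;> first | omega | simp
  rw [sum_Ico_eq_add_add h3, Finset.sum_congr rfl e2, e0, e0, e1, e1, Finset.sum_const,
    Nat.card_Ico, nsmul_eq_mul, Nat.cast_sub (by omega)]
  push_cast
  generalize √(1 - r / 2) = a at *
  generalize √(r / 2) = b at *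
  split_ifs <;> first | omega | (simp; done) | (simp; linarith)

theorem sum_tetrisEntry_mul (hK : 0 < K) (hKL : 3 * K ≤ L) {k k' : ℕ} (hk : k < K) :
    ∑ l ∈ Finset.range L, tetrisEntry L K l k * tetrisEntry L K l k' =
      if k = k' then (L : ℝ) / K else 0 := by
  rw [sum_range_eq_sum_tetrisBlock hK,
    Finset.sum_congr rfl fun c _ => sum_block_tetrisEntry_mul hK hKL c k k']
  split_ifs with h
  · subst h
    simp only [and_self]
    rw [Finset.sum_add_distrib, Finset.sum_ite_eq, Finset.sum_ite_eq,
      if_pos (Finset.mem_range.2 hk)]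
    have h1 := tetrisStart_add_tetrisFrac (L := L) hK k
    have h2 := tetrisStart_add_tetrisFrac (L := L) hK (k + 1)
    -- There is no block `K`, but the fractional part at `K` vanishes as well.
    have h3 : (if k + 1 ∈ Finset.range K then tetrisFrac L K (k + 1) else 0) =
        tetrisFrac L K (k + 1) := by
      split_ifs with h
      · rfl
      · have : k + 1 = K := by rw [Finset.mem_range] at h; omega
        simp [this, tetrisFrac]
    rw [h3]
    push_cast at h2
    linear_combination h2 - h1
  · refine Finset.sum_eq_zero fun c _ => ?_
    rw [if_neg (by omega), if_neg (by omega), add_zero]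

theorem tetrisEntry_eq_zero (hK : 0 < K) (hL : 0 < L) {l k : ℕ}
    (h : ¬(tetrisStart L K k ≤ l ∧ l < tetrisStart L K (k + 1) + 2)) :
    tetrisEntry L K l k = 0 := by
  have hiff := fun j => tetrisStart_le_iff hK hL (k := j) (l := l)
  rw [tetrisEntry]
  split_ifs with h1 h2
  · have := hiff k
    have := hiff (k + 1)
    omega
  · have := hiff k
    rw [tetrisOff, if_neg]
    rw [← h2]
    omega
  · rfl

end Tetris

/-- A tight frame with rows of equal norm in which `K / 2` of the columns have disjoint supports of
size at most `2 L / K`. These are the columns with even index; neighbouring columns overlap in at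
most two rows. -/
theorem exists_sparse_tight_frame {L K : ℕ} (hK : 0 < K) (hKL : 3 * K ≤ L) :
    ∃ D : Matrix (Fin L) (Fin K) ℂ, Dᴴ * D = 1 ∧ (∀ l, ∑ k, ‖D l k‖ ^ 2 = (K : ℝ) / L) ∧
      ∃ (T : Fin (K / 2) → Finset (Fin L)) (c : Fin (K / 2) → Fin K),
        Pairwise (fun i j => Disjoint (T i) (T j)) ∧ (∀ i, ((T i).card : ℝ) ≤ 2 * (L / K)) ∧
        ∀ i, ∀ l, l ∉ T i → D l (c i) = 0 := by
  have hL : 0 < L := by omega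
  have hKr : (0 : ℝ) < K := by exact_mod_cast hK
  have hLr : (0 : ℝ) < L := by exact_mod_cast hL
  have hsq : √((K : ℝ) / L) * √((K : ℝ) / L) = K / L := Real.mul_self_sqrt (by positivity)
  refine ⟨Matrix.of fun l k => ((√((K : ℝ) / L) * tetrisEntry L K l k : ℝ) : ℂ), ?_, ?_,
    fun i => Finset.univ.filter fun l : Fin L =>
      tetrisStart L K (2 * i) ≤ l ∧ (l : ℕ) < tetrisStart L K (2 * i + 1) + 2,
    fun i => ⟨2 * i, by omega⟩, ?_, ?_, ?_⟩
  · ext k k'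
    rw [Matrix.mul_apply]
    have h := sum_tetrisEntry_mul hK hKL (k' := k') k.isLt
    rw [← Fin.sum_univ_eq_sum_range
      (fun l => tetrisEntry L K l k * tetrisEntry L K l k')] at h
    have h2 : ∀ l : Fin L, (Matrix.of fun (l : Fin L) (k : Fin K) =>
        ((√((K : ℝ) / L) * tetrisEntry L K l k : ℝ) : ℂ))ᴴ k l *
        (Matrix.of fun (l : Fin L) (k : Fin K) =>
        ((√((K : ℝ) / L) * tetrisEntry L K l k : ℝ) : ℂ)) l k' =
        (((K : ℝ) / L * (tetrisEntry L K l k * tetrisEntry L K l k') : ℝ) : ℂ) := by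
      intro l
      rw [Matrix.conjTranspose_apply, Matrix.of_apply, Matrix.of_apply, ← starRingEnd_apply,
        Complex.conj_ofReal, ← Complex.ofReal_mul, mul_mul_mul_comm, hsq]
    rw [Finset.sum_congr rfl fun l _ => h2 l, ← Complex.ofReal_sum, ← Finset.mul_sum, h,
      Matrix.one_apply]
    simp only [Fin.ext_iff]
    split_ifs
    · rw [div_mul_div_cancel₀ hLr.ne', div_self hKr.ne', Complex.ofReal_one]
    · simp
  · intro l
    have h := sum_tetrisEntry_sq hK hL l.isLt
    rw [← Fin.sum_univ_eq_sum_range (fun k => tetrisEntry L K l k ^ 2)] at h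
    simp only [Matrix.of_apply, Complex.norm_real, Real.norm_eq_abs, sq_abs, mul_pow]
    rw [← Finset.mul_sum, h, mul_one, sq, hsq]
  · have key : ∀ i j : Fin (K / 2), i < j → Disjoint
        (Finset.univ.filter fun l : Fin L =>
          tetrisStart L K (2 * i) ≤ l ∧ (l : ℕ) < tetrisStart L K (2 * i + 1) + 2)
        (Finset.univ.filter fun l : Fin L =>
          tetrisStart L K (2 * j) ≤ l ∧ (l : ℕ) < tetrisStart L K (2 * j + 1) + 2) := by
      intro i j hij
      rw [Finset.disjoint_filter]
      have h1 := tetrisStart_add_three_le hK hKL (2 * i + 1)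
      have h2 : tetrisStart L K (2 * i + 1 + 1) ≤ tetrisStart L K (2 * j) :=
        monotone_tetrisStart (by omega)
      intro l _ _
      omega
    intro i j hij
    rcases lt_or_gt_of_ne hij with h | h
    · exact key i j h
    · exact (key j i h).symm
  · intro i
    set k : ℕ := 2 * i with hk
    have hcard : (Finset.univ.filter fun l : Fin L =>
        tetrisStart L K k ≤ l ∧ (l : ℕ) < tetrisStart L K (k + 1) + 2).card ≤
        (Finset.Ico (tetrisStart L K k) (tetrisStart L K (k + 1) + 2)).card := by
      apply Finset.card_le_card_of_injOn (fun l : Fin L => (l : ℕ))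
      · intro l hl
        simpa using hl
      · exact fun _ _ _ _ h => Fin.ext h
    rw [Nat.card_Ico] at hcard
    have hmono := tetrisStart_add_three_le hK hKL k
    have hcard' : ((Finset.univ.filter fun l : Fin L =>
        tetrisStart L K k ≤ l ∧ (l : ℕ) < tetrisStart L K (k + 1) + 2).card : ℝ) +
        tetrisStart L K k ≤ tetrisStart L K (k + 1) + 2 := by
      exact_mod_cast (by omega)
    have h1 := tetrisStart_add_tetrisFrac (L := L) hK k
    have h2 := tetrisStart_add_tetrisFrac (L := L) hK (k + 1)
    have h3 := tetrisFrac_le_one (L := L) (K := K) k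
    have h4 := tetrisFrac_nonneg (L := L) (K := K) (k + 1)
    have h5 : (3 : ℝ) ≤ L / K := by
      rw [le_div_iff₀ hKr]; exact_mod_cast hKL
    push_cast at h2
    have h6 : ((k : ℝ) + 1) * L / K = k * L / K + L / K := by ring
    linarith
  · intro i l hl
    have := tetrisEntry_eq_zero hK hL (l := l) (k := 2 * i) (by simpa using hl)
    simp [this]

/-! ### Unitary invariance of the Gaussian law -/

theorem charFunDual_gaussianReal_zero (v : ℝ≥0) (Λ : StrongDual ℝ ℝ) :
    charFunDual (gaussianReal 0 v) Λ = Complex.exp (-(v / 2 * (Λ 1) ^ 2 : ℝ)) := by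
  have h : charFunDual (gaussianReal 0 v) Λ = charFun (gaussianReal 0 v) (Λ 1) := by
    rw [charFunDual_apply, charFun_apply_real]
    congr 1
    ext x
    have : Λ x = x * Λ 1 := by
      have := Λ.map_smul x 1
      simpa using this
    rw [this]
    push_cast
    ring_nf
  rw [h, charFun_gaussianReal]
  congr 1
  push_cast
  ring

instance isProbabilityMeasure_complexGaussian (v : ℝ≥0) :
    IsProbabilityMeasure (complexGaussian v) := by
  rw [complexGaussian]
  exact Measure.isProbabilityMeasure_map (by fun_prop)

instance isProbabilityMeasure_codingLaw (L N : ℕ) : IsProbabilityMeasure (codingLaw L N) := by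
  rw [codingLaw]
  infer_instance

theorem charFunDual_complexGaussian (v : ℝ≥0) (Λ : StrongDual ℝ ℂ) :
    charFunDual (complexGaussian v) Λ =
      Complex.exp (-(v / 4 * ((Λ 1) ^ 2 + (Λ Complex.I) ^ 2) : ℝ)) := by
  have hφ : (fun p : ℝ × ℝ => (p.1 : ℂ) + (p.2 : ℂ) * Complex.I) =
      Complex.equivRealProdCLM.symm.toContinuousLinearMap := by
    ext p
    simp [Complex.equivRealProdCLM_symm_apply]
  rw [complexGaussian, hφ, charFunDual_map, charFunDual_prod, charFunDual_gaussianReal_zero,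
    charFunDual_gaussianReal_zero, ← Complex.exp_add]
  congr 1
  simp [Complex.equivRealProdCLM_symm_apply]
  ring

/-- The characteristic function of the Gaussian law at the functional `C ↦ Re Tr (A* C)`. -/
theorem charFunDual_codingLaw {L N : ℕ} (A : Matrix (Fin L) (Fin N) ℂ)
    (Λ : StrongDual ℝ (Fin L → Fin N → ℂ)) (h : ∀ C, Λ C = (Aᴴ * Matrix.of C).trace.re) :
    charFunDual (codingLaw L N) Λ = Complex.exp (-(1 / (4 * L) * (Aᴴ * A).trace.re : ℝ)) := by
  have hs : ∀ l n z, Λ (Pi.single l (Pi.single n z)) = ((starRingEnd ℂ) (A l n) * z).re := by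
    intro l n z
    rw [h]
    congr 1
    simp only [Matrix.trace, Matrix.diag, Matrix.mul_apply, Matrix.conjTranspose_apply,
      Matrix.of_apply]
    rw [Finset.sum_eq_single n, Finset.sum_eq_single l]
    · simp
    · intro l' _ hl'
      simp [Pi.single_eq_of_ne hl']
    · simp
    · intro n' _ hn'
      refine Finset.sum_eq_zero fun l' _ => ?_
      by_cases hl : l' = l
      · subst hl
        simp [Pi.single_eq_of_ne hn']
      · simp [Pi.single_eq_of_ne hl]
    · simp
  have htr : (Aᴴ * A).trace.re = ∑ l, ∑ n, ‖A l n‖ ^ 2 := by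
    simp only [Matrix.trace, Matrix.diag, Matrix.mul_apply, Matrix.conjTranspose_apply]
    rw [Finset.sum_comm, Complex.re_sum]
    refine Finset.sum_congr rfl fun l _ => ?_
    rw [Complex.re_sum]
    refine Finset.sum_congr rfl fun n _ => ?_
    rw [← Complex.normSq_eq_norm_sq, Complex.normSq_apply]
    simp
  rw [codingLaw, charFunDual_pi]
  simp_rw [charFunDual_pi, charFunDual_complexGaussian]
  simp_rw [← Complex.exp_sum]
  congr 1
  rw [htr]
  simp only [← Complex.ofReal_neg, ← Complex.ofReal_sum]
  congr 1
  rw [Finset.mul_sum, ← Finset.sum_neg_distrib]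
  refine Finset.sum_congr rfl fun l _ => ?_
  rw [Finset.mul_sum, ← Finset.sum_neg_distrib]
  refine Finset.sum_congr rfl fun n _ => ?_
  rw [← Complex.normSq_eq_norm_sq, Complex.normSq_apply]
  simp [hs]
  ring

/-- Every real-linear functional on complex matrices is of the form `C ↦ Re Tr (A* C)`. -/
theorem exists_matrix_eq_re_trace {L N : ℕ} (Λ : StrongDual ℝ (Fin L → Fin N → ℂ)) :
    ∃ A : Matrix (Fin L) (Fin N) ℂ, ∀ C, Λ C = (Aᴴ * Matrix.of C).trace.re := by
  refine ⟨Matrix.of fun l n => (Λ (Pi.single l (Pi.single n 1)) : ℂ) +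
    (Λ (Pi.single l (Pi.single n Complex.I)) : ℂ) * Complex.I, fun C => ?_⟩
  have hC : C = ∑ l, ∑ n, ((C l n).re • (Pi.single l (Pi.single n 1) : Fin L → Fin N → ℂ) +
      (C l n).im • (Pi.single l (Pi.single n Complex.I) : Fin L → Fin N → ℂ)) := by
    ext l n
    rw [Finset.sum_apply, Finset.sum_apply, Finset.sum_eq_single l]
    · rw [Finset.sum_apply, Finset.sum_apply, Finset.sum_eq_single n]
      · simp
      · intro n' _ hn'
        simp [Pi.single_eq_of_ne (Ne.symm hn')]
      · simp
    · intro l' _ hl'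
      rw [Finset.sum_apply, Finset.sum_apply]
      simp [Pi.single_eq_of_ne (Ne.symm hl')]
    · simp
  conv_lhs => rw [hC]
  simp only [map_sum, map_add, map_smul]
  simp only [Matrix.trace, Matrix.diag, Matrix.mul_apply, Matrix.conjTranspose_apply]
  rw [Finset.sum_comm, Complex.re_sum]
  refine Finset.sum_congr rfl fun l _ => ?_
  rw [Complex.re_sum]
  refine Finset.sum_congr rfl fun n _ => ?_
  simp
  ring

/-- The Gaussian law is invariant under multiplication by unitary matrices from both sides: passing
to `F C U` replaces `A` by `F* A U*` in the characteristic function, which depends on `Tr (A* A)`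
only. -/
theorem map_mul_mul_codingLaw {L N : ℕ} {F : Matrix (Fin L) (Fin L) ℂ}
    {U : Matrix (Fin N) (Fin N) ℂ} (hF : F ∈ Matrix.unitaryGroup (Fin L) ℂ)
    (hU : U ∈ Matrix.unitaryGroup (Fin N) ℂ) :
    (codingLaw L N).map (fun C l n => (F * Matrix.of C * U) l n) = codingLaw L N := by
  let T : (Fin L → Fin N → ℂ) →ₗ[ℝ] (Fin L → Fin N → ℂ) :=
    { toFun := fun C l n => (F * Matrix.of C * U) l n
      map_add' := fun C D => by
        ext l n
        change (F * (Matrix.of C + Matrix.of D) * U) l n = _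
        rw [Matrix.mul_add, Matrix.add_mul]
        rfl
      map_smul' := fun a C => by
        ext l n
        change (F * (a • Matrix.of C) * U) l n = _
        rw [Matrix.mul_smul, Matrix.smul_mul]
        rfl }
  have hT : (fun C l n => (F * Matrix.of C * U) l n) = ⇑T.toContinuousLinearMap := rfl
  rw [hT]
  have : IsProbabilityMeasure ((codingLaw L N).map T.toContinuousLinearMap) :=
    Measure.isProbabilityMeasure_map (by fun_prop)
  refine Measure.ext_of_charFunDual (funext fun Λ => ?_)
  obtain ⟨A, hA⟩ := exists_matrix_eq_re_trace Λ
  rw [charFunDual_map, charFunDual_codingLaw A Λ hA, charFunDual_codingLaw (Fᴴ * A * Uᴴ)]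
  · congr 5
    have hFF : F * Fᴴ = 1 := Matrix.mem_unitaryGroup_iff.1 hF
    have hUU : Uᴴ * U = 1 := Matrix.mem_unitaryGroup_iff'.1 hU
    rw [Matrix.conjTranspose_mul, Matrix.conjTranspose_mul, Matrix.conjTranspose_conjTranspose,
      Matrix.conjTranspose_conjTranspose]
    calc (U * (Aᴴ * F) * (Fᴴ * A * Uᴴ)).trace
        = (U * (Aᴴ * (F * Fᴴ) * A * Uᴴ)).trace := by simp only [Matrix.mul_assoc]
      _ = (Aᴴ * A).trace := by
        rw [hFF, Matrix.trace_mul_comm, Matrix.mul_assoc, hUU]; simp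
  · intro C
    rw [ContinuousLinearMap.comp_apply, hA]
    congr 1
    rw [Matrix.conjTranspose_mul, Matrix.conjTranspose_mul, Matrix.conjTranspose_conjTranspose,
      Matrix.conjTranspose_conjTranspose]
    change (Aᴴ * (F * Matrix.of C * U)).trace = _
    rw [← Matrix.mul_assoc, Matrix.trace_mul_comm]
    simp only [Matrix.mul_assoc]

/-! ### Projections onto the span of a family of vectors -/

/-- The orthogonal projection of `v` onto the span of the vectors `g i`. -/
noncomputable def spanProj {ι : Type*} {N : ℕ} (g : ι → Fin N → ℂ)
    (v : EuclideanSpace ℂ (Fin N)) : EuclideanSpace ℂ (Fin N) :=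
  (Submodule.span ℂ (Set.range fun i => WithLp.toLp 2 (g i))).starProjection v

theorem norm_spanProj_sq_add {ι : Type*} {N : ℕ} (g : ι → Fin N → ℂ)
    (v : EuclideanSpace ℂ (Fin N)) : ‖spanProj g v‖ ^ 2 + ‖v - spanProj g v‖ ^ 2 = ‖v‖ ^ 2 := by
  rw [Submodule.norm_sq_eq_add_norm_sq_starProjection v
    (Submodule.span ℂ (Set.range fun i => WithLp.toLp 2 (g i)))]
  simp [spanProj]

theorem inner_sub_spanProj_eq_zero {ι : Type*} {N : ℕ} (g : ι → Fin N → ℂ)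
    (v : EuclideanSpace ℂ (Fin N)) (i : ι) :
    inner ℂ (v - spanProj g v) (WithLp.toLp 2 (g i)) = 0 :=
  Submodule.starProjection_inner_eq_zero v _ (Submodule.subset_span ⟨i, rfl⟩)

theorem le_norm_sub_spanProj_iff {ι : Type*} [Fintype ι] {N : ℕ} (g : ι → Fin N → ℂ)
    (v : EuclideanSpace ℂ (Fin N)) (c : ℝ) :
    c ≤ ‖v - spanProj g v‖ ↔ ∀ a : ι → ℂ, c ≤ ‖v - ∑ i, a i • WithLp.toLp 2 (g i)‖ := by
  have hbdd : BddBelow (Set.range fun x : Submodule.span ℂ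
      (Set.range fun i => (WithLp.toLp 2 (g i) : EuclideanSpace ℂ (Fin N))) => ‖v - x‖) :=
    ⟨0, by rintro _ ⟨x, rfl⟩; exact norm_nonneg _⟩
  rw [spanProj, Submodule.starProjection_minimal, le_ciInf_iff hbdd]
  constructor
  · intro h a
    exact h ⟨_, Submodule.mem_span_range_iff_exists_fun ℂ |>.2 ⟨a, rfl⟩⟩
  · rintro h ⟨x, hx⟩
    obtain ⟨a, rfl⟩ := Submodule.mem_span_range_iff_exists_fun ℂ |>.1 hx
    exact h a

/-- The set where the distance of `v` from the span is at least `c` is closed, being an intersection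
of closed conditions over the coefficient vectors. -/
theorem measurable_norm_spanProj {ι : Type*} [Fintype ι] {N : ℕ} (v : EuclideanSpace ℂ (Fin N)) :
    Measurable fun g : ι → Fin N → ℂ => ‖spanProj g v‖ ^ 2 := by
  have h : Measurable fun g : ι → Fin N → ℂ => ‖v - spanProj g v‖ := by
    refine measurable_of_Ici fun c => IsClosed.measurableSet ?_
    have : (fun g : ι → Fin N → ℂ => ‖v - spanProj g v‖) ⁻¹' Set.Ici c =
        ⋂ a : ι → ℂ,
          {g | c ≤ ‖v - ∑ i, a i • (WithLp.toLp 2 (g i) : EuclideanSpace ℂ (Fin N))‖} := by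
      ext g
      simp [le_norm_sub_spanProj_iff]
    rw [this]
    exact isClosed_iInter fun a => isClosed_le continuous_const (by fun_prop)
  have h2 : (fun g : ι → Fin N → ℂ => ‖spanProj g v‖ ^ 2) =
      fun g => ‖v‖ ^ 2 - ‖v - spanProj g v‖ ^ 2 := by
    ext g
    have := norm_spanProj_sq_add g v
    linarith
  rw [h2]
  fun_prop

/-- The trace of an orthogonal projection is the dimension of its range. -/
theorem sum_norm_spanProj_single_sq_le {ι : Type*} [Fintype ι] {N : ℕ} (g : ι → Fin N → ℂ) :
    ∑ j, ‖spanProj g (EuclideanSpace.single j 1)‖ ^ 2 ≤ Fintype.card ι := by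
  set S := Submodule.span ℂ (Set.range fun i => (WithLp.toLp 2 (g i) : EuclideanSpace ℂ (Fin N)))
    with hS
  let f := stdOrthonormalBasis ℂ S
  have h1 : ∀ x, ‖spanProj g x‖ ^ 2 = ∑ i, ‖inner ℂ (f i : EuclideanSpace ℂ (Fin N)) x‖ ^ 2 := by
    intro x
    change ‖S.starProjection x‖ ^ 2 = _
    rw [Submodule.starProjection_apply, Submodule.norm_coe,
      ← f.sum_sq_norm_inner_right]
    refine Finset.sum_congr rfl fun i _ => ?_
    rw [Submodule.coe_inner, ← Submodule.starProjection_apply,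
      ← Submodule.inner_starProjection_left_eq_right,
      Submodule.starProjection_eq_self_iff.2 (f i).2]
  simp_rw [h1]
  rw [Finset.sum_comm]
  have h2 : ∀ i, ∑ j, ‖inner ℂ (f i : EuclideanSpace ℂ (Fin N)) (EuclideanSpace.single j 1)‖ ^ 2
      = 1 := by
    intro i
    have := (EuclideanSpace.basisFun (Fin N) ℂ).sum_sq_norm_inner_left
      (f i : EuclideanSpace ℂ (Fin N))
    simp only [EuclideanSpace.basisFun_apply] at this
    rw [this, Submodule.norm_coe, f.orthonormal.1 i]
    norm_num
  rw [Finset.sum_congr rfl fun i _ => h2 i]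
  simp only [Finset.sum_const, Finset.card_univ, Fintype.card_fin, nsmul_eq_mul, mul_one]
  exact_mod_cast finrank_range_le_card _

theorem spanProj_linearIsometryEquiv {ι : Type*} {N : ℕ}
    (e : EuclideanSpace ℂ (Fin N) ≃ₗᵢ[ℂ] EuclideanSpace ℂ (Fin N)) {g g' : ι → Fin N → ℂ}
    (h : ∀ i, e (WithLp.toLp 2 (g i)) = WithLp.toLp 2 (g' i)) (v : EuclideanSpace ℂ (Fin N)) :
    spanProj g' (e v) = e (spanProj g v) := by
  have hS : Submodule.span ℂ
      (Set.range fun i => (WithLp.toLp 2 (g' i) : EuclideanSpace ℂ (Fin N))) =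
      (Submodule.span ℂ (Set.range fun i => WithLp.toLp 2 (g i))).map
        (e.toLinearEquiv : EuclideanSpace ℂ (Fin N) →ₗ[ℂ] EuclideanSpace ℂ (Fin N)) := by
    rw [Submodule.map_span, ← Set.range_comp]
    congr 2
    ext1 i
    exact (h i).symm
  simp only [spanProj, hS]
  rw [Submodule.starProjection_map_apply, e.symm_apply_apply]

/-- A unit vector can be rotated onto any standard basis vector by a unitary matrix acting on row
vectors from the right. -/
theorem exists_unitary_vecMul_eq_single {N : ℕ} {v : EuclideanSpace ℂ (Fin N)} (hv : ‖v‖ = 1)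
    (j : Fin N) :
    ∃ U ∈ Matrix.unitaryGroup (Fin N) ℂ,
      ∃ e : EuclideanSpace ℂ (Fin N) ≃ₗᵢ[ℂ] EuclideanSpace ℂ (Fin N),
        (∀ x : Fin N → ℂ, e (WithLp.toLp 2 x) = WithLp.toLp 2 (x ᵥ* U)) ∧
          e v = EuclideanSpace.single j 1 := by
  obtain ⟨b, hb⟩ := Orthonormal.exists_orthonormalBasis_extension_of_card_eq (𝕜 := ℂ)
    (E := EuclideanSpace ℂ (Fin N)) (ι := Fin N) (v := fun _ => v) (s := {j}) (by simp)
    ⟨fun _ => hv, fun i k hik => (hik (Subsingleton.elim _ _)).elim⟩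
  have hbj : b j = v := hb j rfl
  refine ⟨Matrix.of fun n i => star (b i n), ?_, b.repr, ?_, ?_⟩
  · rw [Matrix.mem_unitaryGroup_iff']
    ext i k
    have h := orthonormal_iff_ite.1 b.orthonormal k i
    rw [PiLp.inner_apply] at h
    rw [Matrix.mul_apply, Matrix.one_apply]
    simp only [Matrix.star_apply, Matrix.of_apply, star_star]
    simp only [RCLike.inner_apply, starRingEnd_apply, @eq_comm _ k i] at h
    exact h
  · intro x
    ext i
    rw [b.repr_apply_apply, PiLp.inner_apply]
    simp [Matrix.vecMul, dotProduct]
  · rw [← hbj, b.repr_self]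

/-! ### Projections onto the span of Gaussian rows -/

theorem measurable_norm_spanProj_restrict {L N : ℕ} (T : Finset (Fin L))
    (v : EuclideanSpace ℂ (Fin N)) :
    Measurable fun C : Fin L → Fin N → ℂ => ‖spanProj (fun i : T => C i) v‖ ^ 2 :=
  (measurable_norm_spanProj v).comp
    (measurable_pi_lambda (fun (C : Fin L → Fin N → ℂ) (i : T) => C i)
      fun _ => measurable_pi_apply _)

theorem map_mul_right_codingLaw {L N : ℕ} {U : Matrix (Fin N) (Fin N) ℂ}
    (hU : U ∈ Matrix.unitaryGroup (Fin N) ℂ) :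
    (codingLaw L N).map (fun C l => C l ᵥ* U) = codingLaw L N := by
  have h := map_mul_mul_codingLaw (L := L) (N := N) (one_mem _) hU
  simpa only [Matrix.one_mul] using! h

theorem map_dftMatrix_mul_codingLaw {L N : ℕ} :
    (codingLaw L N).map (fun C l n => (dftMatrix L * Matrix.of C) l n) = codingLaw L N := by
  have h := map_mul_mul_codingLaw (L := L) (N := N) (dftMatrix_mem_unitaryGroup L) (one_mem _)
  simpa only [Matrix.mul_one] using h

theorem measurable_vecMul_rows {L N : ℕ} (U : Matrix (Fin N) (Fin N) ℂ) :
    Measurable fun (C : Fin L → Fin N → ℂ) l => C l ᵥ* U := by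
  unfold Matrix.vecMul dotProduct
  fun_prop

theorem norm_spanProj_sq_le_one {ι : Type*} {N : ℕ} (g : ι → Fin N → ℂ)
    {v : EuclideanSpace ℂ (Fin N)} (hv : ‖v‖ = 1) : ‖spanProj g v‖ ^ 2 ≤ 1 := by
  have := norm_spanProj_sq_add g v
  rw [hv] at this
  nlinarith [sq_nonneg ‖v - spanProj g v‖]

theorem integrable_norm_spanProj_sq {L N : ℕ} (T : Finset (Fin L)) {v : EuclideanSpace ℂ (Fin N)}
    (hv : ‖v‖ = 1) :
    Integrable (fun C => ‖spanProj (fun i : T => C i) v‖ ^ 2) (codingLaw L N) := by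
  refine Integrable.of_bound
    (measurable_norm_spanProj_restrict T v).aestronglyMeasurable 1
    (Filter.Eventually.of_forall fun C => ?_)
  rw [Real.norm_eq_abs, abs_of_nonneg (by positivity)]
  exact norm_spanProj_sq_le_one _ hv

/-- By unitary invariance the expectation is the same for all unit vectors `v`; summed over the
standard basis it is the expected dimension of the span, which is at most the number of rows. -/
theorem integral_norm_spanProj_sq_le {L N : ℕ} (T : Finset (Fin L))
    {v : EuclideanSpace ℂ (Fin N)} (hv : ‖v‖ = 1) :
    N * ∫ C, ‖spanProj (fun i : T => C i) v‖ ^ 2 ∂codingLaw L N ≤ T.card := by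
  have hj : ∀ j : Fin N, ∫ C, ‖spanProj (fun i : T => C i) v‖ ^ 2 ∂codingLaw L N =
      ∫ C, ‖spanProj (fun i : T => C i) (EuclideanSpace.single j 1)‖ ^ 2 ∂codingLaw L N := by
    intro j
    obtain ⟨U, hU, e, he, hev⟩ := exists_unitary_vecMul_eq_single hv j
    conv_rhs => rw [← map_mul_right_codingLaw hU]
    rw [integral_map (measurable_vecMul_rows U).aemeasurable
      (measurable_norm_spanProj_restrict T _).aestronglyMeasurable]
    congr 1
    ext C
    rw [← hev, spanProj_linearIsometryEquiv e (g := fun i : T => C i) (fun i => he (C i)),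
      e.norm_map]
  calc N * ∫ C, ‖spanProj (fun i : T => C i) v‖ ^ 2 ∂codingLaw L N
      = ∑ j : Fin N, ∫ C, ‖spanProj (fun i : T => C i) (EuclideanSpace.single j 1)‖ ^ 2
          ∂codingLaw L N := by
        rw [← Finset.sum_congr rfl fun j _ => hj j]; simp
    _ = ∫ C, ∑ j : Fin N, ‖spanProj (fun i : T => C i) (EuclideanSpace.single j 1)‖ ^ 2
          ∂codingLaw L N := by
        rw [integral_finsetSum]
        exact fun j _ => integrable_norm_spanProj_sq T (by simp)
    _ ≤ ∫ _, (T.card : ℝ) ∂codingLaw L N := by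
        refine integral_mono (integrable_finsetSum _ fun j _ =>
          integrable_norm_spanProj_sq T (by simp)) (integrable_const _) fun C => ?_
        simpa using sum_norm_spanProj_single_sq_le fun i : T => C i
    _ = T.card := by simp

/-- Events that depend on disjoint blocks of independent variables are independent. -/
theorem measure_biInter_preimage_eq_prod {ι κ Ω β : Type*} [DecidableEq ι] [MeasurableSpace Ω]
    [MeasurableSpace β] {μ : Measure Ω} [IsProbabilityMeasure μ] {X : ι → Ω → β}
    (hX : iIndepFun X μ)
    (hm : ∀ i, Measurable (X i)) {T : κ → Finset ι} (hT : Pairwise fun i j => Disjoint (T i) (T j))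
    {A : ∀ k, Set (T k → β)} (hA : ∀ k, MeasurableSet (A k)) (s : Finset κ) :
    μ.real (⋂ k ∈ s, (fun ω (i : T k) => X i ω) ⁻¹' A k) =
      ∏ k ∈ s, μ.real ((fun ω (i : T k) => X i ω) ⁻¹' A k) := by
  classical
  induction s using Finset.induction_on with
  | empty => simp
  | insert a s ha ih =>
    rw [Finset.prod_insert ha, ← ih, Finset.set_biInter_insert]
    have hdisj : Disjoint (T a) (s.biUnion T) := by
      rw [Finset.disjoint_biUnion_right]
      exact fun k hk => hT fun h => ha (h ▸ hk)
    have hind := hX.indepFun_finset (T a) (s.biUnion T) hdisj hm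
    let R : Set (s.biUnion T → β) := ⋂ k : s, (fun (g : s.biUnion T → β) (i : T k) =>
      g ⟨i, Finset.mem_biUnion.2 ⟨k, k.2, i.2⟩⟩) ⁻¹' A k
    have hR : MeasurableSet R := MeasurableSet.iInter fun k =>
      (measurable_pi_lambda _ fun i => measurable_pi_apply _) (hA k)
    have hpre : (⋂ k ∈ s, (fun ω (i : T k) => X i ω) ⁻¹' A k) =
        (fun ω (i : s.biUnion T) => X i ω) ⁻¹' R := by
      ext ω
      simp [R]
    rw [hpre, measureReal_def, hind.measure_inter_preimage_eq_mul _ _ (hA a) hR,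
      ENNReal.toReal_mul]
    rfl

/-- Markov's inequality for each of `M` disjoint sets of rows, and independence. -/
theorem measure_forall_lt_norm_spanProj_le {L N M : ℕ} {v : EuclideanSpace ℂ (Fin N)}
    (hv : ‖v‖ = 1) {T : Fin M → Finset (Fin L)} (hT : Pairwise fun i j => Disjoint (T i) (T j))
    {δ q : ℝ} (hcard : ∀ i, ((T i).card : ℝ) ≤ q * (N * δ)) (hδ : 0 < δ) :
    (codingLaw L N).real {C | ∀ i, δ < ‖spanProj (fun j : T i => C j) v‖ ^ 2} ≤ q ^ M := by
  have hN : 0 < (N : ℝ) := by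
    rcases N.eq_zero_or_pos with rfl | h
    · rw [Subsingleton.elim v 0, norm_zero] at hv
      exact absurd hv (by norm_num)
    · exact_mod_cast h
  have hX : iIndepFun (fun (l : Fin L) (C : Fin L → Fin N → ℂ) => C l) (codingLaw L N) :=
    iIndepFun_pi (X := fun _ x => x) fun _ => aemeasurable_id
  have h := measure_biInter_preimage_eq_prod hX (fun l => measurable_pi_apply l) hT
    (A := fun i => {g | δ < ‖spanProj g v‖ ^ 2})
    (fun i => measurableSet_lt measurable_const (measurable_norm_spanProj v)) Finset.univ
  have hset : {C : Fin L → Fin N → ℂ | ∀ i, δ < ‖spanProj (fun j : T i => C j) v‖ ^ 2} =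
      ⋂ k ∈ Finset.univ, (fun (C : Fin L → Fin N → ℂ) (i : T k) => C i) ⁻¹'
        {g | δ < ‖spanProj g v‖ ^ 2} := by
    ext C
    simp
  rw [hset, h]
  calc _ ≤ ∏ _i : Fin M, q := by
        refine Finset.prod_le_prod (fun _ _ => measureReal_nonneg) fun i _ => ?_
        have h1 := mul_meas_ge_le_integral_of_nonneg
          (Filter.Eventually.of_forall fun C => by positivity)
          (integrable_norm_spanProj_sq (L := L) (T i) hv) δ
        have h2 := integral_norm_spanProj_sq_le (L := L) (T i) hv
        have h3 : (codingLaw L N).real ((fun C (j : T i) => C j) ⁻¹' {g | δ < ‖spanProj g v‖ ^ 2}) ≤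
            (codingLaw L N).real {C | δ ≤ ‖spanProj (fun j : T i => C j) v‖ ^ 2} :=
          measureReal_mono fun C (hC : δ < _) => hC.le
        have h4 : N * (δ * (codingLaw L N).real
            {C | δ ≤ ‖spanProj (fun j : T i => C j) v‖ ^ 2}) ≤ q * (N * δ) :=
          (mul_le_mul_of_nonneg_left h1 hN.le).trans (h2.trans (hcard i))
        refine h3.trans (le_of_mul_le_mul_right ?_ (mul_pos hN hδ))
        linarith
    _ = q ^ M := by simp

/-! ### Concentration of the measurements of a rank-one matrix -/

theorem integral_exp_mul_sq_gaussianReal {v : ℝ≥0} (hv : v ≠ 0) {x : ℝ} (hx : 2 * x * v < 1) :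
    ∫ t, Real.exp (x * t ^ 2) ∂gaussianReal 0 v = √(1 / (1 - 2 * x * v)) := by
  have hv' : (0 : ℝ) < v := by exact_mod_cast hv.bot_lt
  rw [integral_gaussianReal_eq_integral_smul hv]
  have h : ∀ t : ℝ, gaussianPDFReal 0 v t • Real.exp (x * t ^ 2) =
      (√(2 * Real.pi * v))⁻¹ * Real.exp (-((1 - 2 * x * v) / (2 * v)) * t ^ 2) := by
    intro t
    rw [gaussianPDFReal, smul_eq_mul, mul_assoc, ← Real.exp_add]
    congr 2
    field_simp
    ring
  simp_rw [h]
  rw [integral_const_mul, integral_gaussian, ← Real.sqrt_inv, ← Real.sqrt_mul (by positivity)]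
  congr 1
  have : 1 - 2 * x * v ≠ 0 := by linarith
  field_simp

theorem integral_exp_mul_norm_sq_complexGaussian {v : ℝ≥0} (hv : v ≠ 0) {x : ℝ} (hx : x * v < 1) :
    ∫ z, Real.exp (x * ‖z‖ ^ 2) ∂complexGaussian v = 1 / (1 - x * v) := by
  have hv2 : v / 2 ≠ 0 := by simpa using hv
  rw [complexGaussian, integral_map (by fun_prop) (by fun_prop)]
  have h : ∀ p : ℝ × ℝ, Real.exp (x * ‖(p.1 : ℂ) + (p.2 : ℂ) * Complex.I‖ ^ 2) =
      Real.exp (x * p.1 ^ 2) * Real.exp (x * p.2 ^ 2) := by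
    intro p
    rw [← Real.exp_add, ← Complex.normSq_eq_norm_sq, Complex.normSq_add_mul_I]
    ring_nf
  simp_rw [h]
  have hc : 2 * x * ((v / 2 : ℝ≥0) : ℝ) = x * v := by push_cast; ring
  rw [integral_prod_mul (fun t => Real.exp (x * t ^ 2)) (fun t => Real.exp (x * t ^ 2)),
    integral_exp_mul_sq_gaussianReal hv2 (by rwa [hc]), hc,
    Real.mul_self_sqrt (by rw [one_div, inv_nonneg]; linarith)]

theorem one_div_one_sub_le_exp {y : ℝ} (h0 : 0 ≤ y) (h1 : y ≤ 1 / 2) :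
    1 / (1 - y) ≤ Real.exp (2 * y) := by
  rw [div_le_iff₀ (by linarith)]
  have := Real.add_one_le_exp (2 * y)
  nlinarith

theorem integral_exp_sum_codingLaw {L N : ℕ} (n : Fin N) (x : Fin L → ℝ)
    (hx : ∀ l, x l * ((1 / (L : ℝ≥0) : ℝ≥0) : ℝ) < 1) :
    ∫ C, Real.exp (∑ l, x l * ‖C l n‖ ^ 2) ∂codingLaw L N =
      ∏ l, 1 / (1 - x l * ((1 / (L : ℝ≥0) : ℝ≥0) : ℝ)) := by
  simp_rw [Real.exp_sum]
  rw [codingLaw, integral_fintype_prod_eq_prod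
    (f := fun l (c : Fin N → ℂ) => Real.exp (x l * ‖c n‖ ^ 2))]
  refine Finset.prod_congr rfl fun l _ => ?_
  have hL : (1 / (L : ℝ≥0) : ℝ≥0) ≠ 0 := by
    have : (L : ℝ≥0) ≠ 0 := by exact_mod_cast l.pos.ne'
    positivity
  rw [← integral_exp_mul_norm_sq_complexGaussian hL (hx l)]
  have h := (measurePreserving_eval
    (fun _ : Fin N => complexGaussian (1 / (L : ℝ≥0))) n).map_eq
  conv_rhs => rw [← h]
  rw [integral_map (measurable_pi_apply n).aemeasurable (by fun_prop)]

/-- Chernoff's bound with the parameter `L / (2 M)`: then all arguments of the moment generating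
functions are at most half of the critical value, so that `one_div_one_sub_le_exp` applies. -/
theorem measure_four_le_sum_coord_le {L N : ℕ} (n : Fin N) {a : Fin L → ℝ} {M : ℝ} (hM : 0 < M)
    (ha : ∀ l, 0 ≤ a l) (haM : ∀ l, L * a l ≤ M) (hsum : ∑ l, a l = 1) :
    (codingLaw L N).real {C | 4 ≤ ∑ l, a l * (L * ‖C l n‖ ^ 2)} ≤ Real.exp (-(L / M)) := by
  have hL : (0 : ℝ) < L := by
    rcases L.eq_zero_or_pos with rfl | h
    · simp at hsum
    · exact_mod_cast h
  set s : ℝ := L / (2 * M) with hs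
  have hs0 : 0 < s := by positivity
  -- `s * a l` is the argument relative to the critical one, as `L * ‖C l n‖ ^ 2` has mean `1`.
  have hsa : ∀ l, s * a l ≤ 1 / 2 := by
    intro l
    have := haM l
    rw [hs, div_mul_eq_mul_div, div_le_iff₀ (by positivity)]
    linarith
  have hcast : ((1 / (L : ℝ≥0) : ℝ≥0) : ℝ) = 1 / L := by push_cast; rfl
  have hx : ∀ l, s * a l * L * ((1 / (L : ℝ≥0) : ℝ≥0) : ℝ) = s * a l := by
    intro l
    rw [hcast]; field_simp
  have hint := integral_exp_sum_codingLaw (N := N) n (fun l => s * a l * L)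
    (fun l => by rw [hx]; linarith [hsa l])
  simp only [hx] at hint
  have hexp : ∀ C : Fin L → Fin N → ℂ, s * ∑ l, a l * (L * ‖C l n‖ ^ 2) =
      ∑ l, s * a l * L * ‖C l n‖ ^ 2 := by
    intro C
    rw [Finset.mul_sum]
    exact Finset.sum_congr rfl fun l _ => by ring
  have hmgf : mgf (fun C : Fin L → Fin N → ℂ => ∑ l, a l * (L * ‖C l n‖ ^ 2)) (codingLaw L N) s =
      ∏ l, 1 / (1 - s * a l) := by
    rw [mgf, ← hint]
    simp_rw [hexp]
  have hpos : 0 < ∏ l, 1 / (1 - s * a l) :=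
    Finset.prod_pos fun l _ => one_div_pos.2 (by linarith [hsa l])
  have hI : Integrable (fun C : Fin L → Fin N → ℂ =>
      Real.exp (s * ∑ l, a l * (L * ‖C l n‖ ^ 2))) (codingLaw L N) := by
    refine Integrable.of_integral_ne_zero ?_
    rw [mgf] at hmgf
    rw [hmgf]
    exact hpos.ne'
  refine (measure_ge_le_exp_mul_mgf 4 hs0.le hI).trans ?_
  rw [hmgf]
  calc Real.exp (-s * 4) * ∏ l, 1 / (1 - s * a l)
      ≤ Real.exp (-s * 4) * ∏ l, Real.exp (2 * (s * a l)) := by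
        gcongr with l
        · intro l _
          exact one_div_nonneg.2 (by linarith [hsa l])
        · exact one_div_one_sub_le_exp (mul_nonneg hs0.le (ha l)) (hsa l)
    _ = Real.exp (-(L / M)) := by
        rw [← Real.exp_sum, ← Real.exp_add, ← Finset.mul_sum, ← Finset.mul_sum, hsum, hs]
        congr 1
        field_simp
        ring

theorem measure_four_le_sum_inner_le {L N : ℕ} {v : EuclideanSpace ℂ (Fin N)} (hv : ‖v‖ = 1)
    {a : Fin L → ℝ} {M : ℝ} (hM : 0 < M)
    (ha : ∀ l, 0 ≤ a l) (haM : ∀ l, L * a l ≤ M) (hsum : ∑ l, a l = 1) :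
    (codingLaw L N).real {C | 4 ≤ ∑ l, a l * (L * ‖inner ℂ v (WithLp.toLp 2 (C l))‖ ^ 2)} ≤
      Real.exp (-(L / M)) := by
  have hN : 0 < N := by
    rcases N.eq_zero_or_pos with rfl | h
    · rw [Subsingleton.elim v 0, norm_zero] at hv
      exact absurd hv (by norm_num)
    · exact h
  obtain ⟨U, hU, e, he, hev⟩ := exists_unitary_vecMul_eq_single hv ⟨0, hN⟩
  refine le_trans (le_of_eq ?_) (measure_four_le_sum_coord_le ⟨0, hN⟩ hM ha haM hsum)
  conv_rhs => rw [← map_mul_right_codingLaw hU]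
  rw [map_measureReal_apply (measurable_vecMul_rows U)
    (measurableSet_le measurable_const (by fun_prop))]
  congr 1
  ext C
  have h : ∀ l, inner ℂ v (WithLp.toLp 2 (C l)) = (C l ᵥ* U) ⟨0, hN⟩ := by
    intro l
    rw [← e.inner_map_map, hev, he, EuclideanSpace.inner_single_left]
    simp
  simp [h]

/-! ### Assembling the instability result -/

theorem dftMatrix_mul_conjTranspose_mul {L K : ℕ} (D : Matrix (Fin L) (Fin K) ℂ) :
    dftMatrix L * ((dftMatrix L)ᴴ * D) = D := by
  rw [← Matrix.mul_assoc, dftMatrix_mul_conjTranspose, Matrix.one_mul]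

theorem bVec_conjTranspose_dftMatrix_mul {L K : ℕ} (D : Matrix (Fin L) (Fin K) ℂ) (l : Fin L) :
    bVec ((dftMatrix L)ᴴ * D) l = WithLp.toLp 2 fun k => star (D l k) := by
  rw [bVec, dftMatrix_mul_conjTranspose_mul]

/-- The vectors `b_ℓ` form a Parseval frame. -/
theorem sum_norm_inner_bVec_sq {L K : ℕ} {B : Matrix (Fin L) (Fin K) ℂ} (hB : Bᴴ * B = 1)
    (u : EuclideanSpace ℂ (Fin K)) : ∑ l, ‖inner ℂ (bVec B l) u‖ ^ 2 = ‖u‖ ^ 2 := by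
  have hF : (dftMatrix L)ᴴ * dftMatrix L = 1 :=
    Matrix.mem_unitaryGroup_iff'.1 (dftMatrix_mem_unitaryGroup L)
  set D := dftMatrix L * B with hD
  have hDD : Dᴴ * D = 1 := by
    rw [hD, Matrix.conjTranspose_mul, Matrix.mul_assoc, ← Matrix.mul_assoc _ _ B, hF,
      Matrix.one_mul, hB]
  have h1 : ∀ l, inner ℂ (bVec B l) u = (D *ᵥ u.ofLp) l := by
    intro l
    simp [bVec, PiLp.inner_apply, Matrix.mulVec, dotProduct, ← hD, mul_comm]
  have h2 : star (D *ᵥ u.ofLp) ⬝ᵥ (D *ᵥ u.ofLp) = star u.ofLp ⬝ᵥ u.ofLp := by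
    rw [Matrix.star_mulVec, Matrix.dotProduct_mulVec, Matrix.vecMul_vecMul, hDD, Matrix.vecMul_one]
  have h3 : ∀ {n : ℕ} (x : Fin n → ℂ), star x ⬝ᵥ x = ((∑ i, ‖x i‖ ^ 2 : ℝ) : ℂ) := by
    intro n x
    simp only [dotProduct, Pi.star_apply, Complex.ofReal_sum]
    refine Finset.sum_congr rfl fun i _ => ?_
    rw [← starRingEnd_apply, Complex.conj_mul']
    push_cast
    rfl
  rw [h3, h3] at h2
  rw [EuclideanSpace.norm_sq_eq]
  simp_rw [h1]
  exact_mod_cast h2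

theorem cVec_eq_smul {L N : ℕ} (C : Matrix (Fin L) (Fin N) ℂ) (l : Fin L) :
    cVec C l = (√L : ℂ) • WithLp.toLp 2 ((dftMatrix L * C) l) := by
  ext n
  simp [cVec]

theorem norm_measOp_outer_sq {L K N : ℕ} (B : Matrix (Fin L) (Fin K) ℂ)
    (C : Matrix (Fin L) (Fin N) ℂ) (u : EuclideanSpace ℂ (Fin K)) (v : EuclideanSpace ℂ (Fin N)) :
    ‖measOp B C (outer u v)‖ ^ 2 = ∑ l, ‖inner ℂ (bVec B l) u‖ ^ 2 *
      (L * ‖inner ℂ v (WithLp.toLp 2 ((dftMatrix L * C) l))‖ ^ 2) := by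
  rw [EuclideanSpace.norm_sq_eq]
  refine Finset.sum_congr rfl fun l _ => ?_
  rw [measOp_outer_apply, cVec_eq_smul, inner_smul_right, norm_mul, norm_mul, mul_pow, mul_pow,
    Complex.norm_real, Real.norm_eq_abs, sq_abs, Real.sq_sqrt (Nat.cast_nonneg L)]

theorem one_third_pow_le_exp {K : ℕ} (hK : 2 ≤ K) {M : ℝ} (hM : 1 ≤ M) :
    (1 / 3 : ℝ) ^ (K / 2) ≤ Real.exp (-(K / (3 * M))) := by
  have h1 : (1 / 3 : ℝ) ≤ Real.exp (-1) := by
    rw [Real.exp_neg, one_div]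
    gcongr
    linarith [Real.exp_one_lt_d9]
  have h2 : (K : ℝ) ≤ 3 * ((K / 2 : ℕ) : ℝ) := by exact_mod_cast (by omega)
  calc (1 / 3 : ℝ) ^ (K / 2) ≤ Real.exp (-1) ^ (K / 2) := by gcongr
    _ = Real.exp (-((K / 2 : ℕ) : ℝ)) := by rw [← Real.exp_nat_mul]; ring_nf
    _ ≤ Real.exp (-(K / (3 * M))) := by
      gcongr
      rw [div_le_iff₀ (by positivity)]
      nlinarith [Nat.cast_nonneg (α := ℝ) (K / 2)]

/-- The event of the theorem: for one of the sets `T i` the projection of `v` onto the span of the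
rows of `F C` in `T i` is short, and the weighted sum of the squared inner products of `v` with all
the rows is below its bound. The weights will be `|⟨b_ℓ, u⟩|²`, for which that sum is `‖𝒜 (u v*)‖²`. -/
theorem one_sub_le_measure_good_event {L N K : ℕ} (hK : 2 ≤ K) (hKL : K ≤ L)
    {v : EuclideanSpace ℂ (Fin N)}
    (hv : ‖v‖ = 1) {T : Fin (K / 2) → Finset (Fin L)}
    (hT : Pairwise fun i j => Disjoint (T i) (T j)) {δ : ℝ}
    (hcard : ∀ i, ((T i).card : ℝ) ≤ 1 / 3 * (N * δ)) (hδ : 0 < δ)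
    {a : Fin L → ℝ} {M : ℝ} (hM : 1 ≤ M) (ha : ∀ l, 0 ≤ a l) (haM : ∀ l, L * a l ≤ M)
    (hsum : ∑ l, a l = 1) :
    ∃ E : Set (Fin L → Fin N → ℂ), MeasurableSet E ∧
      1 - 2 * Real.exp (-((K : ℝ) / (3 * M))) ≤ (codingLaw L N).real E ∧
      ∀ C ∈ E, (∃ i, ‖spanProj (fun j : T i => (dftMatrix L * Matrix.of C) j) v‖ ^ 2 ≤ δ) ∧
        ∑ l, a l * (L * ‖inner ℂ v (WithLp.toLp 2 ((dftMatrix L * Matrix.of C) l))‖ ^ 2) < 4 := by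
  let S₁ : Set (Fin L → Fin N → ℂ) := {C | ∀ i, δ < ‖spanProj (fun j : T i => C j) v‖ ^ 2}
  let S₂ : Set (Fin L → Fin N → ℂ) :=
    {C | 4 ≤ ∑ l, a l * (L * ‖inner ℂ v (WithLp.toLp 2 (C l))‖ ^ 2)}
  have hS₁ : MeasurableSet S₁ := by
    have : S₁ = ⋂ i, {C | δ < ‖spanProj (fun j : T i => C j) v‖ ^ 2} := by
      ext C; simp [S₁]
    rw [this]
    exact MeasurableSet.iInter fun i =>
      measurableSet_lt measurable_const (measurable_norm_spanProj_restrict (T i) v)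
  have hS₂ : MeasurableSet S₂ := measurableSet_le measurable_const (by fun_prop)
  have hΦ : Measurable fun (C : Fin L → Fin N → ℂ) l n => (dftMatrix L * Matrix.of C) l n := by
    simp only [Matrix.mul_apply, Matrix.of_apply]
    fun_prop
  refine ⟨(fun C l n => (dftMatrix L * Matrix.of C) l n) ⁻¹' (S₁ ∪ S₂)ᶜ,
    hΦ (hS₁.union hS₂).compl, ?_, ?_⟩
  · rw [← map_measureReal_apply hΦ (hS₁.union hS₂).compl, map_dftMatrix_mul_codingLaw,
      probReal_compl_eq_one_sub (hS₁.union hS₂)]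
    have h1 : (codingLaw L N).real S₁ ≤ Real.exp (-((K : ℝ) / (3 * M))) :=
      (measure_forall_lt_norm_spanProj_le hv hT hcard hδ).trans (one_third_pow_le_exp hK hM)
    have h2 : (codingLaw L N).real S₂ ≤ Real.exp (-((K : ℝ) / (3 * M))) := by
      refine (measure_four_le_sum_inner_le hv (by linarith) ha haM hsum).trans ?_
      have hKL' : (K : ℝ) ≤ L := by exact_mod_cast hKL
      gcongr
      linarith
    linarith [measureReal_union_le (μ := codingLaw L N) S₁ S₂]
  · intro C hC
    simp only [Set.mem_preimage, Set.mem_compl_iff, Set.mem_union, not_or, S₁, S₂,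
      Set.mem_ofPred_eq, not_forall, not_lt, not_le] at hC
    exact hC

theorem norm_inv_norm_smul {E : Type*} [NormedAddCommGroup E] [NormedSpace ℂ E] {x : E}
    (hx : x ≠ 0) : ‖((‖x‖ : ℂ)⁻¹) • x‖ = 1 ∧ x = (‖x‖ : ℂ) • (((‖x‖ : ℂ)⁻¹) • x) := by
  have h : (‖x‖ : ℂ) ≠ 0 := by exact_mod_cast norm_ne_zero_iff.2 hx
  refine ⟨?_, by rw [smul_smul, mul_inv_cancel₀ h, one_smul]⟩
  simp [norm_smul, hx]

theorem mul_norm_inner_bVec_sq_le_muSq {L K : ℕ} (B : Matrix (Fin L) (Fin K) ℂ)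
    (h₀ : EuclideanSpace ℂ (Fin K)) (l : Fin L) :
    L * ‖inner ℂ (bVec B l) (((‖h₀‖ : ℂ)⁻¹) • h₀)‖ ^ 2 ≤ muSq B h₀ := by
  rw [inner_smul_right, norm_mul, mul_pow, muSq, norm_inv, Complex.norm_real, norm_norm, inv_pow,
    ← mul_assoc, ← div_eq_mul_inv]
  gcongr
  exact le_ciSup (f := fun l => ‖inner ℂ (bVec B l) h₀‖ ^ 2) (Set.finite_range _).bddAbove l

theorem theorem3 :
    ∃ C₁ C₂ C₃ C₄ : ℝ, 0 < C₁ ∧ 0 < C₂ ∧ 0 < C₃ ∧ 0 < C₄ ∧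
      ∀ K N L : ℕ, 2 ≤ K → 2 ≤ N →
        C₁ * (K : ℝ) ≤ (L : ℝ) → (L : ℝ) ≤ (K : ℝ) * (N : ℝ) / 36 →
        ∃ B : Matrix (Fin L) (Fin K) ℂ,
          Bᴴ * B = 1 ∧
          (∀ l l' : Fin L, ‖bVec B l‖ = ‖bVec B l'‖) ∧
          muMaxSq B = 1 ∧
          ∀ (h₀ : EuclideanSpace ℂ (Fin K)) (m₀ : EuclideanSpace ℂ (Fin N)),
            h₀ ≠ 0 → m₀ ≠ 0 →
            ∃ E : Set (Fin L → Fin N → ℂ), MeasurableSet E ∧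
              1 - C₄ * Real.exp (-((K : ℝ) / (C₂ * muSq B h₀))) ≤ (codingLaw L N).real E ∧
              ∀ C ∈ E, UnstableAt B (Matrix.of C) h₀ m₀
                (1 / C₃ * Real.sqrt ((K : ℝ) * (N : ℝ) / (L : ℝ))) := by
  refine ⟨3, 3, 15, 2, by norm_num, by norm_num, by norm_num, by norm_num,
    fun K N L hK hN hKL hLN => ?_⟩
  have hKL' : 3 * K ≤ L := by exact_mod_cast hKL
  have hK0 : (0 : ℝ) < K := by exact_mod_cast (by omega)
  have hN0 : (0 : ℝ) < N := by exact_mod_cast (by omega)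
  have hL0 : (0 : ℝ) < L := by exact_mod_cast (by omega)
  have : NeZero L := ⟨by omega⟩
  obtain ⟨D, hD, hrow, T, c, hT, hcard, hzero⟩ := exists_sparse_tight_frame (by omega) hKL'
  have hB : ((dftMatrix L)ᴴ * D)ᴴ * ((dftMatrix L)ᴴ * D) = 1 := by
    rw [Matrix.conjTranspose_mul, Matrix.conjTranspose_conjTranspose, Matrix.mul_assoc,
      dftMatrix_mul_conjTranspose_mul, hD]
  have hb : ∀ l, ‖bVec ((dftMatrix L)ᴴ * D) l‖ ^ 2 = K / L := by
    intro l
    rw [bVec_conjTranspose_dftMatrix_mul, EuclideanSpace.norm_sq_eq, ← hrow l]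
    simp
  refine ⟨(dftMatrix L)ᴴ * D, hB, fun l l' => ?_, ?_, fun h₀ m₀ hh hm => ?_⟩
  · rw [← sq_eq_sq₀ (norm_nonneg _) (norm_nonneg _), hb, hb]
  · simp only [muMaxSq, hb, ciSup_const]
    field_simp
  set B := (dftMatrix L)ᴴ * D with hBdef
  obtain ⟨hu1, hu⟩ := norm_inv_norm_smul hh
  obtain ⟨hv1, hv⟩ := norm_inv_norm_smul hm
  have haM := mul_norm_inner_bVec_sq_le_muSq B h₀
  set u := ((‖h₀‖ : ℂ)⁻¹) • h₀
  set v := ((‖m₀‖ : ℂ)⁻¹) • m₀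
  have hsum : ∑ l, ‖inner ℂ (bVec B l) u‖ ^ 2 = 1 := by
    rw [sum_norm_inner_bVec_sq hB, hu1, one_pow]
  -- A maximum is at least the mean; the exponents of both tail bounds are compared through this.
  have hmu : 1 ≤ muSq B h₀ := by
    have h1 : ∑ l, L * ‖inner ℂ (bVec B l) u‖ ^ 2 ≤ ∑ _l : Fin L, muSq B h₀ :=
      Finset.sum_le_sum fun l _ => haM l
    rw [← Finset.mul_sum, hsum] at h1
    simp only [Finset.sum_const, Finset.card_univ, Fintype.card_fin, nsmul_eq_mul] at h1
    exact le_of_mul_le_mul_left h1 hL0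
  set ε : ℝ := √(L / (K * N)) with hε
  have hε0 : 0 < ε := by positivity
  have hε2 : ε ^ 2 = L / (K * N) := Real.sq_sqrt (by positivity)
  have hε36 : ε ^ 2 ≤ 1 / 36 := by
    rw [hε2, div_le_iff₀ (by positivity)]
    linarith
  have hε6 : ε ≤ 1 / 6 := abs_le_of_sq_le_sq' (by linarith) (by norm_num) |>.2
  have hcard' : ∀ i, ((T i).card : ℝ) ≤ 1 / 3 * (N * (6 * ε ^ 2)) := by
    intro i
    refine (hcard i).trans (le_of_eq ?_)
    rw [hε2]
    field_simp
    norm_num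
  obtain ⟨E, hE, hPE, hgood⟩ := one_sub_le_measure_good_event hK (by omega) hv1 hT hcard'
    (by positivity) hmu (fun l => by positivity) haM hsum
  refine ⟨E, hE, hPE, fun C hC => ?_⟩
  obtain ⟨⟨i, hi⟩, hlt⟩ := hgood C hC
  have hsqrt : √((K : ℝ) * N / L) = 1 / ε := by
    rw [hε, one_div, ← Real.sqrt_inv, inv_div]
  rw [hsqrt]
  set w := spanProj (fun j : T i => (dftMatrix L * Matrix.of C) j) v with hw
  have hpyth : ‖w‖ ^ 2 + ‖v - w‖ ^ 2 = 1 := by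
    rw [hw, norm_spanProj_sq_add, hv1, one_pow]
  refine unstableAt_of_descent (x := EuclideanSpace.single (c i) 1) hh hm hε0 hε6 hu hv
    (by simp) (w := w) ?_ ?_ (fun l => ?_) ?_
  · refine abs_le_of_sq_le_sq' ?_ (by positivity) |>.2
    rw [mul_pow]
    linarith [sq_nonneg ε]
  · refine abs_le_of_sq_le_sq' ?_ (norm_nonneg _) |>.2
    linarith
  · by_cases hl : l ∈ T i
    · right
      rw [cVec_eq_smul, inner_smul_right, hw,
        inner_sub_spanProj_eq_zero (fun j : T i => (dftMatrix L * Matrix.of C) j) v ⟨l, hl⟩,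
        mul_zero]
    · left
      rw [hBdef, bVec_conjTranspose_dftMatrix_mul, EuclideanSpace.inner_single_right]
      simp [hzero i l hl]
  · refine abs_le_of_sq_le_sq' ?_ (by norm_num) |>.2
    rw [norm_measOp_outer_sq]
    linarith
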